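/- Consider the $M/M/n$ (Erlang-C) queue with $n$ servers, arrival rate $\lambda$ and service rate $\mu$ per server, and offered load $R=\lambda/\mu$. The number of customers in the system is the continuous-time Markov chain $X$ on $\{0,1,2,\dots\}$ that jumps from $k$ to $k+1$ at rate $\lambda$ and from $k$ to $k-1$ at rate $\mu\min(k,n)$. For $R<n$ let $X(\infty)$ have its stationary distribution. With $x^-=\max(-x,0)$ put $$\zeta=\frac{R-n}{\sqrt R},\qquad b(x)=\mu\big[(x+\zeta)^-+\zeta\big],\qquad a(x)=\mu\Big[1+1(x>-\sqrt R)\Big(1-\frac{(x+\zeta)^-+\zeta}{\sqrt R}\Big)\Big].$$ Let $Y(\infty)$ be a real random variable with density $\frac{\kappa}{a(x)}\exp\big(\int_0^x\frac{2b(y)}{a(y)}\,dy\big)$ (state-dependent diffusion coefficient $a$), and $Y_0(\infty)$ one with density $\kappa_0\exp\big(\int_0^x\frac{b(y)}{\mu}\,dy\big)$ (constant diffusion coefficient $2\mu$), where $\kappa,\kappa_0>0$ are normalizing constants. There exist constants $C_{W_2}>0$ and $C_0>0$, independent of $\lambda$, $n$ and $\mu$, such that for all integers $n\ge 1$ and all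 $\lambda>0$, $\mu>0$ with $1\le R<n$, the stationary distribution exists and is unique, $Y(\infty)$ and $Y_0(\infty)$ are well defined, $X(\infty)$, $Y(\infty)$ and $Y_0(\infty)$ have finite means, and $$\Big|\mathbb E X(\infty)-\big(R+\sqrt R\,\mathbb E Y(\infty)\big)\Big|\le\frac{C_{W_2}}{\sqrt R},\qquad \Big|\mathbb E X(\infty)-\big(R+\sqrt R\,\mathbb E Y_0(\infty)\big)\Big|\le C_0 .$$ That is, the error of the mean approximation based on $Y(\infty)$ vanishes at rate $1/\sqrt R$, while for the constant-coefficient approximation $Y_0(\infty)$ the gap is bounded. -/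

import Mathlib

open MeasureTheory

noncomputable section

namespace ErlangC

/-- Transition rates (`Q`-matrix) of the number of customers in the `M/M/n` queue with arrival
rate `lam` and service rate `mu`: up by one at rate `lam`, down by one from `j` at rate
`mu * min j n`; the diagonal makes the rows sum to zero. -/
def rate (lam mu : ℝ) (n : ℕ) (j k : ℕ) : ℝ :=
  if k = j + 1 then lam
  else if j = k + 1 then mu * (min j n : ℕ)
  else if j = k then -(lam + mu * (min j n : ℕ))
  else 0

/-- `π` is a stationary distribution of the continuous time Markov chain with the rates `rate`:
a probability measure on the states with `π Q = 0`. -/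
structure IsStationary (lam mu : ℝ) (n : ℕ) (π : Measure ℕ) : Prop where
  isProbabilityMeasure : IsProbabilityMeasure π
  balance : ∀ k : ℕ, HasSum (fun j : ℕ => π.real {j} * rate lam mu n j k) 0

/-- The offered load `R = lam / mu`. -/
def load (lam mu : ℝ) : ℝ := lam / mu

/-- `ζ = (R - n) / √R`. -/
def zeta (lam mu : ℝ) (n : ℕ) : ℝ := (load lam mu - n) / √(load lam mu)

/-- The drift `b(x) = mu [(x + ζ)⁻ + ζ]`. -/
def drift (lam mu : ℝ) (n : ℕ) (x : ℝ) : ℝ :=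
  mu * (max (-(x + zeta lam mu n)) 0 + zeta lam mu n)

/-- The state dependent diffusion coefficient
`a(x) = mu [1 + 1(x > -√R) (1 - ((x + ζ)⁻ + ζ) / √R)]`. -/
def diffusion (lam mu : ℝ) (n : ℕ) (x : ℝ) : ℝ :=
  mu * (1 + if -√(load lam mu) < x then
    1 - (max (-(x + zeta lam mu n)) 0 + zeta lam mu n) / √(load lam mu) else 0)

/-- The probability law on `ℝ` with density proportional to `g`. -/
def lawOfDensity (g : ℝ → ℝ) : Measure ℝ :=
  volume.withDensity fun x => ENNReal.ofReal ((∫ y, g y)⁻¹ * g x)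

/-- The law of `Y(∞)`, with density `κ / a(x) * exp (∫₀ˣ 2 b(y) / a(y) dy)`. -/
def lawY (lam mu : ℝ) (n : ℕ) : Measure ℝ :=
  lawOfDensity fun x => 1 / diffusion lam mu n x *
    Real.exp (∫ y in (0 : ℝ)..x, 2 * drift lam mu n y / diffusion lam mu n y)

/-- The law of `Y₀(∞)`, with density `κ * exp (∫₀ˣ b(y) / mu dy)`. -/
def lawY₀ (lam mu : ℝ) (n : ℕ) : Measure ℝ :=
  lawOfDensity fun x => Real.exp (∫ y in (0 : ℝ)..x, drift lam mu n y / mu)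

end ErlangC

end

/-! Write `r = √R`, `z = -ζ` and `D = n - R = r z`. Stationarity gives `E min(X, n) = R` for the
queue and `E min(Y, z) = 0` for both diffusions. So `E X - R` and `E Y` are expected excesses over
`n` and over `z`, where the tails are geometric or exponential. The three means are therefore
explicit: `E X - R = R / (D (1 + D a))`, `r E Y = (R + D/2) / (D (1 + D b))`, `r E Y₀ = R / (D (1 +
D c))`. Here `a`, `b`, `c` are Laplace-type integrals of `exp (D w - R V w)` over `w > 0`, with `V`
equal to `e^w - 1 - w` (an incomplete Gamma integral), `-4 log (1 - w/2) - 2 w` and `w²/2`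
respectively. The integral `b` also carries the weight `1 / (1 - w/2)`, is cut off at some `W < 2`,
and includes a small remainder `τ` from the region `x ≤ -r`.

For `Y₀` the potentials differ at order `w³`, and the error equals `R (c - a) / ((1 + D a)(1 + D
c))`, which a third moment controls (`abs_sub_le_of_gauss`). For `Y` the potentials agree through
order `w³`. Integration by parts turns `(R + D/2) a + 1/2` into `R K`, where `K` carries the weight
`(1 + e^w)/2`; this weight agrees with `1 / (1 - w/2)` through order `w²`. The error is then `R (b -
K) / ((1 + D a)(1 + D b))`, one factor `1/r` smaller (`abs_integral_sub_integral_le`,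
`abs_sub_le_div_of_tail`).

Uniformity in `z` has two ingredients. Integration by parts bounds each moment by a power of `1 + z`
times the normalizer `1 + D J₀` (`tiltedMoment_bounds`), and the remaining normalizer is at least a
constant times `(1 + z)^4` (`one_add_pow_le_integral_exp`), which absorbs that power. -/

noncomputable section

namespace ErlangC

/-! ### Moments of the densities `exp (D w - R V w)` -/

/-- `V` is a potential on `[0, ∞)`, at least as convex as `w ^ 2 / 2`, with derivative `V'`. -/
structure IsPotential (V V' : ℝ → ℝ) : Prop where
  zero : V 0 = 0
  hasDerivAt : ∀ w, HasDerivAt V (V' w) w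
  continuous_deriv : Continuous V'
  le_deriv : ∀ w, 0 ≤ w → w ≤ V' w
  deriv_le : ∀ w, 0 ≤ w → V' w ≤ Real.exp w
  sq_le : ∀ w, 0 ≤ w → w ^ 2 / 2 ≤ V w

/-- The `k`-th moment of the density `exp (D w - R V w)` on `(0, ∞)`. -/
def tiltedMoment (D R : ℝ) (V : ℝ → ℝ) (k : ℕ) : ℝ :=
  ∫ w in Set.Ioi (0 : ℝ), w ^ k * Real.exp (D * w - R * V w)

theorem hasDerivAt_exp_tilt {V : ℝ → ℝ} {v w : ℝ} (hV : HasDerivAt V v w) (D R : ℝ) :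
    HasDerivAt (fun w => Real.exp (D * w - R * V w)) (Real.exp (D * w - R * V w) * (D - R * v))
      w := by
  have h1 : HasDerivAt (fun w => D * w - R * V w) (D - R * v) w := by
    simpa using ((hasDerivAt_id' w).const_mul D).fun_sub (hV.const_mul R)
  exact h1.exp

theorem hasDerivAt_pow_mul_exp_tilt {V : ℝ → ℝ} {v w : ℝ} (hV : HasDerivAt V v w) (D R : ℝ)
    (k : ℕ) :
    HasDerivAt (fun w => w ^ (k + 1) * Real.exp (D * w - R * V w))
      ((k + 1) * (w ^ k * Real.exp (D * w - R * V w)) +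
        D * (w ^ (k + 1) * Real.exp (D * w - R * V w)) -
        R * (w ^ (k + 1) * (v * Real.exp (D * w - R * V w)))) w := by
  refine ((hasDerivAt_pow (k + 1) w).fun_mul (hasDerivAt_exp_tilt hV D R)).congr_deriv ?_
  simp only [Nat.cast_add, Nat.cast_one, Nat.add_sub_cancel]
  ring

theorem isPotential_sq : IsPotential (fun w => w ^ 2 / 2) (fun w => w) where
  zero := by norm_num
  hasDerivAt w := by
    exact ((hasDerivAt_pow 2 w).div_const 2).congr_deriv (by norm_num)
  continuous_deriv := continuous_id
  le_deriv w _ := le_rfl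
  deriv_le w _ := by linarith [Real.add_one_le_exp w]
  sq_le w _ := le_rfl

/-- The potential `exp w - 1 - w`. -/
def expPotential (w : ℝ) : ℝ := Real.exp w - 1 - w

theorem isPotential_expPotential : IsPotential expPotential (fun w => Real.exp w - 1) where
  zero := by norm_num [expPotential]
  hasDerivAt w := ((Real.hasDerivAt_exp w).sub_const 1).sub (hasDerivAt_id w)
  continuous_deriv := by fun_prop
  le_deriv w _ := by linarith [Real.add_one_le_exp w]
  deriv_le w _ := by linarith
  sq_le w hw := by
    rw [expPotential]
    linarith [Real.quadratic_le_exp_of_nonneg hw]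

namespace IsPotential

variable {V V' : ℝ → ℝ}

theorem continuous (h : IsPotential V V') : Continuous V :=
  continuous_iff_continuousAt.2 fun w => (h.hasDerivAt w).continuousAt

theorem integrableOn_exp (h : IsPotential V V') {R : ℝ} (hR : 0 < R) (c : ℝ) :
    IntegrableOn (fun w => Real.exp (c * w - R * V w)) (Set.Ioi 0) := by
  have h1 : Integrable fun w : ℝ => Real.exp (c ^ 2 / (2 * R)) *
      Real.exp (-(R / 2) * (w - c / R) ^ 2) :=
    ((integrable_exp_neg_mul_sq (half_pos hR)).comp_sub_right (c / R)).const_mul _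
  have hc := h.continuous
  refine h1.integrableOn.mono' (by fun_prop) ?_
  refine (ae_restrict_mem measurableSet_Ioi).mono fun w hw => ?_
  rw [Real.norm_of_nonneg (Real.exp_pos _).le, ← Real.exp_add]
  refine Real.exp_le_exp.2 ?_
  have h2 := mul_le_mul_of_nonneg_left (h.sq_le w (le_of_lt hw)) hR.le
  have h3 : c ^ 2 / (2 * R) + -(R / 2) * (w - c / R) ^ 2 = c * w - R * (w ^ 2 / 2) := by
    field_simp; ring
  linarith

theorem pow_le_factorial_mul_exp {w : ℝ} (hw : 0 ≤ w) (k : ℕ) :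
    w ^ k ≤ k.factorial * Real.exp w := by
  have := Real.pow_div_factorial_le_exp w hw k
  rwa [div_le_iff₀ (by positivity), mul_comm] at this

theorem integrableOn_pow_mul_exp (h : IsPotential V V') {R : ℝ} (hR : 0 < R) (c : ℝ) (k : ℕ) :
    IntegrableOn (fun w => w ^ k * Real.exp (c * w - R * V w)) (Set.Ioi 0) := by
  have hc := h.continuous
  refine ((h.integrableOn_exp hR (c + 1)).const_mul (k.factorial : ℝ)).mono' (by fun_prop) ?_
  refine (ae_restrict_mem measurableSet_Ioi).mono fun w hw => ?_
  have hw' : 0 ≤ w := le_of_lt hw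
  rw [Real.norm_of_nonneg (by positivity),
    show (c + 1) * w - R * V w = w + (c * w - R * V w) by ring, Real.exp_add, ← mul_assoc]
  exact mul_le_mul_of_nonneg_right (pow_le_factorial_mul_exp hw' k) (Real.exp_pos _).le

/-- Since `V' w ≤ exp w`, the factor `V'` costs no more than replacing `c` by `c + 1`. -/
theorem integrableOn_pow_mul_deriv_mul_exp (h : IsPotential V V') {R : ℝ} (hR : 0 < R) (c : ℝ)
    (k : ℕ) :
    IntegrableOn (fun w => w ^ k * (V' w * Real.exp (c * w - R * V w))) (Set.Ioi 0) := by
  have hc := h.continuous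
  have hc' := h.continuous_deriv
  refine (h.integrableOn_pow_mul_exp hR (c + 1) k).mono' (by fun_prop) ?_
  refine (ae_restrict_mem measurableSet_Ioi).mono fun w hw => ?_
  have hw' : 0 ≤ w := le_of_lt hw
  have h1 := h.le_deriv w hw'
  rw [Real.norm_of_nonneg (by have := hw'.trans h1; positivity),
    show (c + 1) * w - R * V w = w + (c * w - R * V w) by ring, Real.exp_add]
  gcongr
  exact h.deriv_le w hw'

/-- Integration by parts: the derivative of `exp (D w - R V w)` integrates to minus its value `1` at
`0`. -/
theorem integral_deriv_mul_exp (h : IsPotential V V') {R : ℝ} (hR : 0 < R) (D : ℝ) :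
    R * ∫ w in Set.Ioi (0 : ℝ), V' w * Real.exp (D * w - R * V w) =
      1 + D * tiltedMoment D R V 0 := by
  have i0 := h.integrableOn_pow_mul_exp hR D 0
  have i1 := h.integrableOn_pow_mul_deriv_mul_exp hR D 0
  simp only [pow_zero, one_mul] at i0 i1
  have hd : ∀ w, HasDerivAt (fun w => Real.exp (D * w - R * V w))
      (D * Real.exp (D * w - R * V w) - R * (V' w * Real.exp (D * w - R * V w))) w := by
    intro w
    exact (hasDerivAt_exp_tilt (h.hasDerivAt w) D R).congr_deriv (by ring)
  have hi := (i0.const_mul D).sub (i1.const_mul R)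
  have ht := tendsto_zero_of_hasDerivAt_of_integrableOn_Ioi (fun w _ => hd w) hi i0
  have := integral_Ioi_of_hasDerivAt_of_tendsto' (fun w _ => hd w) hi ht
  rw [integral_sub (i0.const_mul D) (i1.const_mul R), integral_const_mul, integral_const_mul,
    h.zero] at this
  simp only [tiltedMoment, pow_zero, one_mul]
  simp at this
  linarith

theorem integral_pow_mul_deriv_mul_exp (h : IsPotential V V') {R : ℝ} (hR : 0 < R) (D : ℝ)
    (k : ℕ) :
    R * ∫ w in Set.Ioi (0 : ℝ), w ^ (k + 1) * (V' w * Real.exp (D * w - R * V w)) =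
      D * tiltedMoment D R V (k + 1) + (k + 1) * tiltedMoment D R V k := by
  have i0 := h.integrableOn_pow_mul_exp hR D k
  have i1 := h.integrableOn_pow_mul_exp hR D (k + 1)
  have i2 := h.integrableOn_pow_mul_deriv_mul_exp hR D (k + 1)
  have hd := fun w => hasDerivAt_pow_mul_exp_tilt (h.hasDerivAt w) D R k
  have hi := ((i0.const_mul (k + 1 : ℝ)).add (i1.const_mul D)).sub (i2.const_mul R)
  have ht := tendsto_zero_of_hasDerivAt_of_integrableOn_Ioi (fun w _ => hd w) hi i1
  have := integral_Ioi_of_hasDerivAt_of_tendsto' (fun w _ => hd w) hi ht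
  have i01 : IntegrableOn (fun w => (k + 1 : ℝ) * (w ^ k * Real.exp (D * w - R * V w)) +
      D * (w ^ (k + 1) * Real.exp (D * w - R * V w))) (Set.Ioi 0) :=
    (i0.const_mul (k + 1 : ℝ)).add (i1.const_mul D)
  rw [integral_sub i01 (i2.const_mul R), integral_add (i0.const_mul (k + 1 : ℝ)) (i1.const_mul D),
    integral_const_mul, integral_const_mul, integral_const_mul] at this
  simp only [tiltedMoment]
  simp at this
  linarith

theorem tiltedMoment_nonneg (D R : ℝ) (V : ℝ → ℝ) (k : ℕ) : 0 ≤ tiltedMoment D R V k :=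
  setIntegral_nonneg measurableSet_Ioi fun w hw => by
    have : 0 < w := hw
    positivity

theorem mul_tiltedMoment_one_le (h : IsPotential V V') {R : ℝ} (hR : 0 < R) (D : ℝ) :
    R * tiltedMoment D R V 1 ≤ 1 + D * tiltedMoment D R V 0 := by
  rw [← h.integral_deriv_mul_exp hR]
  have i1 := h.integrableOn_pow_mul_deriv_mul_exp hR D 0
  simp only [pow_zero, one_mul] at i1
  refine mul_le_mul_of_nonneg_left ?_ hR.le
  refine setIntegral_mono_on (h.integrableOn_pow_mul_exp hR D 1) i1 measurableSet_Ioi ?_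
  intro w hw
  rw [pow_one]
  exact mul_le_mul_of_nonneg_right (h.le_deriv w (le_of_lt hw)) (Real.exp_pos _).le

/-- Convexity enters through `w ≤ V' w`: one factor `w` is traded for `V'`, which integration by
parts removes. -/
theorem mul_tiltedMoment_add_two_le (h : IsPotential V V') {R : ℝ} (hR : 0 < R) (D : ℝ) (k : ℕ) :
    R * tiltedMoment D R V (k + 2) ≤
      D * tiltedMoment D R V (k + 1) + (k + 1) * tiltedMoment D R V k := by
  rw [← h.integral_pow_mul_deriv_mul_exp hR]
  refine mul_le_mul_of_nonneg_left ?_ hR.le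
  refine setIntegral_mono_on (h.integrableOn_pow_mul_exp hR D (k + 2))
    (h.integrableOn_pow_mul_deriv_mul_exp hR D (k + 1)) measurableSet_Ioi ?_
  intro w hw
  have hw' : 0 < w := hw
  rw [pow_succ w (k + 1), mul_assoc]
  gcongr
  exact h.le_deriv w hw'.le

/-- For `z ≥ 1` the right side already contains `r z J₀ ≥ r J₀`. For `z ≤ 1` the mass within `1/r`
of the origin is at most `e/r`, and the rest is bounded by `r J₁`. The constant `4` is `3 + 1`, from
`e ≤ 3` and `r² J₁ ≤ 1 + r z J₀`. -/
theorem sqrt_mul_tiltedMoment_zero_le (h : IsPotential V V') {r z : ℝ} (hr : 0 < r) (hz : 0 < z) :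
    r * tiltedMoment (r * z) (r ^ 2) V 0 ≤ 4 * (1 + r * z * tiltedMoment (r * z) (r ^ 2) V 0) := by
  have hR : 0 < r ^ 2 := by positivity
  have hJ := tiltedMoment_nonneg (r * z) (r ^ 2) V 0
  rcases le_total 1 z with h1 | h1
  · nlinarith [mul_nonneg hr.le hJ, mul_nonneg (mul_nonneg hr.le hJ) (sub_nonneg.2 h1)]
  have i0 := h.integrableOn_pow_mul_exp hR (r * z) 0
  have i1 := h.integrableOn_pow_mul_exp hR (r * z) 1
  have iI : IntegrableOn (fun _ : ℝ => Real.exp 1) (Set.Ioc 0 (1 / r)) := by simp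
  have key : tiltedMoment (r * z) (r ^ 2) V 0 ≤
      Real.exp 1 * (1 / r) + r * tiltedMoment (r * z) (r ^ 2) V 1 := by
    have e1 : Real.exp 1 * (1 / r) =
        ∫ w in Set.Ioi (0 : ℝ), (Set.Ioc 0 (1 / r)).indicator (fun _ => Real.exp 1) w := by
      rw [setIntegral_indicator measurableSet_Ioc,
        Set.inter_eq_right.2 Set.Ioc_subset_Ioi_self]
      simp [hr.le, mul_comm]
    rw [e1]
    unfold tiltedMoment
    rw [← integral_const_mul, ← integral_add _ (i1.const_mul r)]
    · refine setIntegral_mono_on i0 ?_ measurableSet_Ioi ?_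
      · exact ((integrable_indicator_iff measurableSet_Ioc).2 iI).integrableOn.add
          (i1.const_mul r)
      intro w hw
      have hw' : 0 < w := hw
      have hV : 0 ≤ V w := (by positivity : 0 ≤ w ^ 2 / 2).trans (h.sq_le w hw'.le)
      by_cases hwr : w ≤ 1 / r
      · rw [Set.indicator_of_mem (show w ∈ Set.Ioc 0 (1 / r) from ⟨hw', hwr⟩)]
        have : Real.exp (r * z * w - r ^ 2 * V w) ≤ Real.exp 1 := by
          refine Real.exp_le_exp.2 ?_
          rw [le_div_iff₀ hr] at hwr
          nlinarith [mul_nonneg hR.le hV, mul_pos hw' hr]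
        have h3 : 0 ≤ r * (w ^ 1 * Real.exp (r * z * w - r ^ 2 * V w)) := by positivity
        simp only [pow_zero, one_mul]
        linarith
      · rw [Set.indicator_of_notMem (fun hm => hwr hm.2)]
        push Not at hwr
        rw [div_lt_iff₀ hr] at hwr
        have := Real.exp_pos (r * z * w - r ^ 2 * V w)
        simp only [pow_zero, one_mul, pow_one]
        nlinarith
    · exact ((integrable_indicator_iff measurableSet_Ioc).2 iI).integrableOn
  have h1' := h.mul_tiltedMoment_one_le hR (r * z)
  have e : Real.exp 1 ≤ 3 := by linarith [Real.exp_one_lt_d9]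
  have h2 := mul_le_mul_of_nonneg_left key hr.le
  have h3 : r * (Real.exp 1 * (1 / r) + r * tiltedMoment (r * z) (r ^ 2) V 1) =
    Real.exp 1 + r ^ 2 * tiltedMoment (r * z) (r ^ 2) V 1 := by field_simp
  have h4 : 0 ≤ r * z * tiltedMoment (r * z) (r ^ 2) V 0 := by positivity
  linarith

/-- The natural width in `w` is `1/r`, so the `k`-th moment scales as `r^(-k-1)`. Iterating the
moment recursion costs a power of `1 + z` and the normalizer `F`. -/
theorem tiltedMoment_bounds (h : IsPotential V V') {r z : ℝ} (hr : 0 < r) (hz : 0 < z) {F : ℝ}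
    (hF : F = 1 + r * z * tiltedMoment (r * z) (r ^ 2) V 0) :
    r * tiltedMoment (r * z) (r ^ 2) V 0 ≤ 4 * F ∧
    r ^ 2 * tiltedMoment (r * z) (r ^ 2) V 1 ≤ F ∧
    r ^ 3 * tiltedMoment (r * z) (r ^ 2) V 2 ≤ 4 * (1 + z) * F ∧
    r ^ 4 * tiltedMoment (r * z) (r ^ 2) V 3 ≤ 4 * (1 + z) ^ 2 * F ∧
    r ^ 5 * tiltedMoment (r * z) (r ^ 2) V 4 ≤ 16 * (1 + z) ^ 3 * F := by
  have hR : 0 < r ^ 2 := by positivity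
  have b0 := h.sqrt_mul_tiltedMoment_zero_le hr hz
  have b1 := h.mul_tiltedMoment_one_le hR (r * z)
  rw [← hF] at b0 b1
  have s2 := mul_le_mul_of_nonneg_left (h.mul_tiltedMoment_add_two_le hR (r * z) 0) hr.le
  have s3 := mul_le_mul_of_nonneg_left (h.mul_tiltedMoment_add_two_le hR (r * z) 1) hR.le
  have s4 := mul_le_mul_of_nonneg_left (h.mul_tiltedMoment_add_two_le hR (r * z) 2)
    (pow_pos hr 3).le
  have hF0 : 0 ≤ F := by
    have := tiltedMoment_nonneg (r * z) (r ^ 2) V 0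
    rw [hF]; positivity
  norm_num at s2 s3 s4
  generalize tiltedMoment (r * z) (r ^ 2) V 0 = J0 at *
  generalize tiltedMoment (r * z) (r ^ 2) V 1 = J1 at *
  generalize tiltedMoment (r * z) (r ^ 2) V 2 = J2 at *
  generalize tiltedMoment (r * z) (r ^ 2) V 3 = J3 at *
  generalize tiltedMoment (r * z) (r ^ 2) V 4 = J4 at *
  have b2 : r ^ 3 * J2 ≤ z * F + 4 * F := by
    have := mul_le_mul_of_nonneg_left b1 hz.le
    linarith
  have b3 : r ^ 4 * J3 ≤ z * (z * F + 4 * F) + 2 * F := by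
    have := mul_le_mul_of_nonneg_left b2 hz.le
    linarith
  have b4 : r ^ 5 * J4 ≤ z * (z * (z * F + 4 * F) + 2 * F) + 3 * (z * F + 4 * F) := by
    have := mul_le_mul_of_nonneg_left b3 hz.le
    linarith
  have p1 : 0 ≤ z * F := by positivity
  have p2 : 0 ≤ z ^ 2 * F := by positivity
  have p3 : 0 ≤ z ^ 3 * F := by positivity
  refine ⟨b0, b1, ?_, ?_, ?_⟩ <;> linarith

end IsPotential

/-! ### Growth of the normalizers in `z` -/

/-- The integral `∫₀¹ exp (D w - R w²) dw`, for `D = r z` and `R = r²`, grows faster than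
any power of `z`. -/
theorem one_add_pow_le_integral_exp {r z : ℝ} (hr : 1 ≤ r) (hz : 0 < z) :
    (1 + z) ^ 4 ≤
      100000 * (1 + r * z * ∫ w in (0 : ℝ)..1, Real.exp (r * z * w - r ^ 2 * w ^ 2)) := by
  have hr0 : 0 < r := by linarith
  -- On `[t/2, t]` with `t r ≤ z/2` the exponent `r w (z - r w)` is at least `r w z / 2 ≥ t r z /
  -- 4`.
  have window : ∀ t : ℝ, 0 < t → t ≤ 1 → t * r ≤ z / 2 →
      t / 2 * Real.exp (t * (r * z) / 4) ≤
        ∫ w in (0 : ℝ)..1, Real.exp (r * z * w - r ^ 2 * w ^ 2) := by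
    intro t ht ht1 htz
    have hc : Continuous fun w : ℝ => Real.exp (r * z * w - r ^ 2 * w ^ 2) := by fun_prop
    have h1 : ∫ w in (t / 2)..t, Real.exp (t * (r * z) / 4) ≤
        ∫ w in (t / 2)..t, Real.exp (r * z * w - r ^ 2 * w ^ 2) := by
      refine intervalIntegral.integral_mono_on (by linarith) (by simp)
        (hc.intervalIntegrable _ _) ?_
      intro w hw
      refine Real.exp_le_exp.2 ?_
      have hw1 := hw.1
      have hw2 := hw.2
      have e1 : r * w ≤ z / 2 := by nlinarith
      have e2 : 0 ≤ w * r * (z / 2 - r * w) := by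
        have : 0 ≤ w := by linarith
        have := sub_nonneg.2 e1
        positivity
      have e3 : 0 ≤ (w - t / 2) * (r * z) := by
        have := sub_nonneg.2 hw1
        positivity
      linarith
    rw [intervalIntegral.integral_const, smul_eq_mul] at h1
    have h2 : ∫ w in (t / 2)..t, Real.exp (r * z * w - r ^ 2 * w ^ 2) ≤
        ∫ w in (0 : ℝ)..1, Real.exp (r * z * w - r ^ 2 * w ^ 2) :=
      intervalIntegral.integral_mono_interval (by linarith) (by linarith) ht1
        (Filter.Eventually.of_forall fun w => (Real.exp_pos _).le) (hc.intervalIntegrable _ _)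
    linarith
  have main : z ^ 4 / 12288 ≤
      r * z * ∫ w in (0 : ℝ)..1, Real.exp (r * z * w - r ^ 2 * w ^ 2) := by
    rcases le_total z r with hzr | hzr
    -- The peak `w = z / (2 r)` of the exponent lies in `[0, 1]`, and a linear bound on `exp (z²/8)`
    -- suffices.
    · have hw := window (z / (2 * r)) (by positivity)
        (by rw [div_le_one (by positivity)]; linarith) (le_of_eq (by field_simp))
      have hw' := mul_le_mul_of_nonneg_left hw (by positivity : 0 ≤ r * z)
      have e := Real.add_one_le_exp (z / (2 * r) * (r * z) / 4)
      have e1 : z / (2 * r) * (r * z) / 4 = z ^ 2 / 8 := by field_simp; ring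
      have e2 : r * z * (z / (2 * r) / 2 * Real.exp (z / (2 * r) * (r * z) / 4)) =
        z ^ 2 / 4 * Real.exp (z / (2 * r) * (r * z) / 4) := by field_simp; ring
      rw [e2] at hw'
      rw [e1] at e hw'
      nlinarith [mul_le_mul_of_nonneg_left e (by positivity : 0 ≤ z ^ 2 / 4), sq_nonneg z]
    -- The peak may now leave `[0, 1]`, so a fixed window is used. The cubic term of the exponential
    -- gives `(r z)^4 / 12288`.
    · have hw := window (1 / 2) (by norm_num) (by norm_num) (by linarith)
      have hw' := mul_le_mul_of_nonneg_left hw (by positivity : 0 ≤ r * z)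
      have e := Real.pow_div_factorial_le_exp (1 / 2 * (r * z) / 4) (by positivity) 3
      have e1 : r * z * ((1 / 2 * (r * z) / 4) ^ 3 / (Nat.factorial 3)) =
        (r * z) ^ 4 / 3072 := by norm_num [Nat.factorial]; ring
      have e2 := mul_le_mul_of_nonneg_left e (by positivity : 0 ≤ r * z)
      rw [e1] at e2
      have e3 : z ^ 4 ≤ (r * z) ^ 4 := by
        refine pow_le_pow_left₀ hz.le ?_ 4
        nlinarith
      linarith
  -- `(1 + z)^4 ≤ 8 (1 + z^4)` and `8 * 12288 = 98304`, which is where `100000` comes from.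
  nlinarith [sq_nonneg (z - 1), sq_nonneg (z ^ 2 - 1), sq_nonneg (z ^ 2 - z), pow_pos hz 4]

/-! ### Comparison of the logarithmic, exponential and quadratic potentials -/

/-- The potential `-4 log (1 - w / 2) - 2 w` on `[0, 2)`. -/
def logPotential (w : ℝ) : ℝ := -4 * Real.log (1 - w / 2) - 2 * w

theorem nonneg_of_deriv_nonneg {f f' : ℝ → ℝ} {b : ℝ} (h0 : f 0 = 0)
    (hd : ∀ w ∈ Set.Icc 0 b, HasDerivAt f (f' w) w) (hn : ∀ w ∈ Set.Icc 0 b, 0 ≤ f' w)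
    (hb : 0 ≤ b) :
    0 ≤ f b := by
  rw [← h0]
  refine monotoneOn_of_hasDerivWithinAt_nonneg (convex_Icc 0 b)
    (fun w hw => (hd w hw).continuousAt.continuousWithinAt)
    (fun w hw => (hd w (interior_subset hw)).hasDerivWithinAt)
    (fun w hw => hn w (interior_subset hw)) (Set.left_mem_Icc.2 hb) (Set.right_mem_Icc.2 hb) hb

theorem logPotential_zero : logPotential 0 = 0 := by simp [logPotential]

theorem expPotential_zero : expPotential 0 = 0 := by simp [expPotential]

theorem hasDerivAt_logPotential {w : ℝ} (hw : w < 2) :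
    HasDerivAt logPotential (w / (1 - w / 2)) w := by
  have h1 : (1 - w / 2) ≠ 0 := by linarith
  have h2 : HasDerivAt (fun w : ℝ => 1 - w / 2) (-(1 / 2)) w :=
    ((hasDerivAt_id' w).div_const 2).const_sub 1
  have h3 := ((h2.log h1).const_mul (-4)).fun_sub ((hasDerivAt_id' w).const_mul 2)
  refine h3.congr_deriv ?_
  have h4 : 2 - w ≠ 0 := by linarith
  field_simp
  ring

theorem hasDerivAt_expPotential (w : ℝ) : HasDerivAt expPotential (Real.exp w - 1) w :=
  isPotential_expPotential.hasDerivAt w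

/-- This is `e^w ≤ (2 + w) / (2 - w)`, a Padé bound; it orders the derivatives of the two
potentials. -/
theorem exp_sub_one_le {w : ℝ} (hw : 0 ≤ w) (hw2 : w < 2) : Real.exp w - 1 ≤ w / (1 - w / 2) := by
  have hf : 0 ≤ 2 + w - Real.exp w * (2 - w) := by
    refine nonneg_of_deriv_nonneg (f := fun w => 2 + w - Real.exp w * (2 - w))
      (f' := fun w => 1 - Real.exp w * (1 - w)) (by simp) (fun x _ => ?_) (fun x _ => ?_) hw
    · refine (((hasDerivAt_id' x).const_add 2).fun_sub
        ((Real.hasDerivAt_exp x).fun_mul ((hasDerivAt_id' x).const_sub 2))).congr_deriv ?_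
      ring
    · have h1 := Real.one_sub_le_exp_neg x
      have h2 := mul_le_mul_of_nonneg_left h1 (Real.exp_pos x).le
      rw [← Real.exp_add, add_neg_cancel, Real.exp_zero] at h2
      linarith
  rw [le_div_iff₀ (by linarith)]
  linarith

theorem expPotential_le_logPotential {w : ℝ} (hw : 0 ≤ w) (hw2 : w < 2) :
    expPotential w ≤ logPotential w := by
  rw [← sub_nonneg]
  refine nonneg_of_deriv_nonneg (f := fun w => logPotential w - expPotential w)
    (by simp [logPotential_zero, expPotential_zero])
    (fun x hx => (hasDerivAt_logPotential (hx.2.trans_lt hw2)).fun_sub (hasDerivAt_expPotential x))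
    (fun x hx => sub_nonneg.2 (exp_sub_one_le hx.1 (hx.2.trans_lt hw2))) hw

/-- Both potentials expand as `w²/2 + w³/6 + O(w⁴)`. This matching of the cubic terms is what gains
the factor `1/√R` for the state dependent coefficient. -/
theorem logPotential_sub_expPotential_le {w : ℝ} (hw : 0 ≤ w) (hw1 : w ≤ 1) :
    logPotential w - expPotential w ≤ w ^ 4 / 8 := by
  rw [← sub_nonneg]
  refine nonneg_of_deriv_nonneg
    (f := fun w => w ^ 4 / 8 - (logPotential w - expPotential w))
    (by simp [logPotential_zero, expPotential_zero])
    (fun x hx => ((hasDerivAt_pow 4 x).div_const 8).fun_sub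
      ((hasDerivAt_logPotential (by linarith [hx.2])).fun_sub (hasDerivAt_expPotential x)))
    (fun x hx => ?_) hw
  have h1 := Real.quadratic_le_exp_of_nonneg hx.1
  have h2 : x ≤ 1 := hx.2.trans hw1
  have h3 : x / (1 - x / 2) ≤ x + x ^ 2 / 2 + x ^ 3 / 2 := by
    rw [div_le_iff₀ (by linarith)]
    nlinarith [mul_nonneg (pow_nonneg hx.1 3) (sub_nonneg.2 h2)]
  norm_num
  linarith

theorem logPotential_sub_sq_le {w : ℝ} (hw : 0 ≤ w) (hw1 : w ≤ 1) :
    logPotential w - w ^ 2 / 2 ≤ w ^ 3 / 3 := by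
  rw [← sub_nonneg]
  refine nonneg_of_deriv_nonneg
    (f := fun w => w ^ 3 / 3 - (logPotential w - w ^ 2 / 2))
    (by simp [logPotential_zero])
    (fun x hx => ((hasDerivAt_pow 3 x).div_const 3).fun_sub
      ((hasDerivAt_logPotential (by linarith [hx.2])).fun_sub ((hasDerivAt_pow 2 x).div_const 2)))
    (fun x hx => ?_) hw
  have h2 : x ≤ 1 := hx.2.trans hw1
  have h3 : x / (1 - x / 2) ≤ x + x ^ 2 := by
    rw [div_le_iff₀ (by linarith)]
    nlinarith [mul_nonneg (pow_nonneg hx.1 2) (sub_nonneg.2 h2)]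
  norm_num
  linarith

theorem logPotential_le_sq {w : ℝ} (hw : 0 ≤ w) (hw1 : w ≤ 1) : logPotential w ≤ w ^ 2 := by
  have := logPotential_sub_sq_le hw hw1
  nlinarith [mul_nonneg (pow_nonneg hw 2) (sub_nonneg.2 hw1)]

/-- The bound carries the factor `e^w - 1`, the derivative of `expPotential`, so that integration by
parts can remove it. -/
theorem exp_remainder_le {w : ℝ} (hw : 0 ≤ w) :
    Real.exp w - 1 - w - w ^ 2 / 2 ≤ w ^ 2 * (Real.exp w - 1) := by
  rw [← sub_nonneg]
  refine nonneg_of_deriv_nonneg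
    (f := fun w => w ^ 2 * (Real.exp w - 1) - (Real.exp w - 1 - w - w ^ 2 / 2))
    (by simp)
    (fun x hx => ((hasDerivAt_pow 2 x).fun_mul ((Real.hasDerivAt_exp x).sub_const 1)).fun_sub
      ((((Real.hasDerivAt_exp x).sub_const 1).fun_sub (hasDerivAt_id' x)).fun_sub
        ((hasDerivAt_pow 2 x).div_const 2)))
    (fun x hx => ?_) hw
  have h0 := hx.1
  have h1 := Real.one_sub_le_exp_neg x
  have h2 := mul_le_mul_of_nonneg_left h1 (Real.exp_pos x).le
  rw [← Real.exp_add, add_neg_cancel, Real.exp_zero] at h2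
  have h3 := Real.add_one_le_exp x
  have h4 : 0 ≤ x * (Real.exp x - 1) := mul_nonneg h0 (by linarith)
  have h5 : 0 ≤ x ^ 2 * Real.exp x := by positivity
  norm_num
  linarith

/-! ### Comparing the truncated logarithmic integral with the exponential one -/

section Interval

variable {D R W : ℝ}

theorem continuousOn_logPotential (hW2 : W < 2) : ContinuousOn logPotential (Set.Icc 0 W) :=
  fun _ hw => (hasDerivAt_logPotential (hw.2.trans_lt hW2)).continuousAt.continuousWithinAt

theorem intervalIntegrable_mul_exp_logPotential (hW : 0 ≤ W) (hW2 : W < 2) {f : ℝ → ℝ}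
    (hf : ContinuousOn f (Set.Icc 0 W)) (D R : ℝ) :
    IntervalIntegrable (fun w => f w * Real.exp (D * w - R * logPotential w)) volume 0 W := by
  refine ContinuousOn.intervalIntegrable ?_
  rw [Set.uIcc_of_le hW]
  have := continuousOn_logPotential hW2
  fun_prop

theorem continuousOn_div_one_sub (hW2 : W < 2) {f : ℝ → ℝ} (hf : Continuous f) :
    ContinuousOn (fun w => f w / (1 - w / 2)) (Set.Icc 0 W) := by
  refine ContinuousOn.div hf.continuousOn (by fun_prop) fun w hw => ?_
  have := hw.2
  linarith

/-- Truncated moments of the logarithmic potential are at most those of the exponential one. -/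
theorem integral_pow_mul_exp_logPotential_le (hR : 0 < R) (hW : 0 ≤ W) (hW2 : W < 2) (k : ℕ) :
    ∫ w in (0 : ℝ)..W, w ^ k * Real.exp (D * w - R * logPotential w) ≤
      tiltedMoment D R expPotential k := by
  have hi := isPotential_expPotential.integrableOn_pow_mul_exp hR D k
  calc ∫ w in (0 : ℝ)..W, w ^ k * Real.exp (D * w - R * logPotential w)
      ≤ ∫ w in (0 : ℝ)..W, w ^ k * Real.exp (D * w - R * expPotential w) := by
        refine intervalIntegral.integral_mono_on hW
          (intervalIntegrable_mul_exp_logPotential hW hW2 (by fun_prop) D R) ?_ ?_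
        · rw [intervalIntegrable_iff_integrableOn_Ioc_of_le hW]
          exact hi.mono_set Set.Ioc_subset_Ioi_self
        intro w hw
        have := expPotential_le_logPotential hw.1 (hw.2.trans_lt hW2)
        have := pow_nonneg hw.1 k
        gcongr
    _ ≤ tiltedMoment D R expPotential k := by
        rw [intervalIntegral.integral_of_le hW]
        refine setIntegral_mono_set hi ?_ Set.Ioc_subset_Ioi_self.eventuallyLE
        refine (ae_restrict_mem measurableSet_Ioi).mono fun w hw => ?_
        have : 0 < w := hw
        simp only [Pi.zero_apply]
        positivity

theorem integral_pow_mul_deriv_mul_exp_logPotential (hW : 0 ≤ W) (hW2 : W < 2) (k : ℕ) :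
    R * (∫ w in (0 : ℝ)..W, w ^ (k + 1) * (w / (1 - w / 2)) *
        Real.exp (D * w - R * logPotential w)) +
      W ^ (k + 1) * Real.exp (D * W - R * logPotential W) =
      D * (∫ w in (0 : ℝ)..W, w ^ (k + 1) * Real.exp (D * w - R * logPotential w)) +
      (k + 1) * ∫ w in (0 : ℝ)..W, w ^ k * Real.exp (D * w - R * logPotential w) := by
  have i0 := intervalIntegrable_mul_exp_logPotential (f := fun w => w ^ k) hW hW2 (by fun_prop) D R
  have i1 := intervalIntegrable_mul_exp_logPotential (f := fun w => w ^ (k + 1)) hW hW2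
    (by fun_prop) D R
  have i2 := intervalIntegrable_mul_exp_logPotential (f := fun w => w ^ (k + 1) * (w / (1 - w / 2)))
    hW hW2 ((continuous_pow (k + 1)).continuousOn.mul
      (continuousOn_div_one_sub hW2 continuous_id)) D R
  have hd : ∀ w ∈ Set.uIcc 0 W, _ := fun w hw =>
    hasDerivAt_pow_mul_exp_tilt (hasDerivAt_logPotential (w := w)
      (by rw [Set.uIcc_of_le hW] at hw; exact hw.2.trans_lt hW2)) D R k
  have i01 := (i0.const_mul (k + 1 : ℝ)).add (i1.const_mul D)
  have e : ∀ w : ℝ, R * (w ^ (k + 1) * (w / (1 - w / 2) * Real.exp (D * w - R * logPotential w))) =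
      R * (w ^ (k + 1) * (w / (1 - w / 2)) * Real.exp (D * w - R * logPotential w)) := by
    intro w; ring
  simp only [e] at hd
  have := intervalIntegral.integral_eq_sub_of_hasDerivAt hd (i01.sub (i2.const_mul R))
  rw [intervalIntegral.integral_sub i01 (i2.const_mul R),
    intervalIntegral.integral_add (i0.const_mul (k + 1 : ℝ)) (i1.const_mul D),
    intervalIntegral.integral_const_mul, intervalIntegral.integral_const_mul,
    intervalIntegral.integral_const_mul] at this
  simp only [ne_eq, Nat.add_eq_zero_iff, one_ne_zero, and_false, not_false_eq_true, zero_pow,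
    zero_mul, sub_zero] at this
  linarith

/-- The boundary term at `W` in the integration by parts is nonnegative and is dropped. -/
theorem mul_integral_sq_mul_deriv_le (hD : 0 ≤ D) (hR : 0 < R) (hW : 0 ≤ W) (hW2 : W < 2) :
    R * (∫ w in (0 : ℝ)..W, w ^ 2 * (w / (1 - w / 2)) *
        Real.exp (D * w - R * logPotential w)) ≤
      D * tiltedMoment D R expPotential 2 + 2 * tiltedMoment D R expPotential 1 := by
  have h := integral_pow_mul_deriv_mul_exp_logPotential (D := D) (R := R) hW hW2 1
  have h1 := integral_pow_mul_exp_logPotential_le (D := D) hR hW hW2 1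
  have h2 := mul_le_mul_of_nonneg_left
    (integral_pow_mul_exp_logPotential_le (D := D) hR hW hW2 2) hD
  have h3 : 0 ≤ W ^ 2 * Real.exp (D * W - R * logPotential W) := by positivity
  norm_num at h h1 h2
  linarith

/-- Here the boundary term at `W` is the one kept; it will bound the contribution `τ` of the
diffusion below `-√R`. -/
theorem exp_logPotential_le (hD : 0 ≤ D) (hR : 0 < R) (hW : 1 ≤ W) (hW2 : W < 2) :
    Real.exp (D * W - R * logPotential W) ≤
      D * tiltedMoment D R expPotential 1 + tiltedMoment D R expPotential 0 := by
  have hW0 : 0 ≤ W := by linarith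
  have h := integral_pow_mul_deriv_mul_exp_logPotential (D := D) (R := R) hW0 hW2 0
  have h1 := integral_pow_mul_exp_logPotential_le (D := D) hR hW0 hW2 0
  have h2 := mul_le_mul_of_nonneg_left
    (integral_pow_mul_exp_logPotential_le (D := D) hR hW0 hW2 1) hD
  have h3 := mul_le_mul_of_nonneg_right hW (Real.exp_pos (D * W - R * logPotential W)).le
  have h4 : 0 ≤ ∫ w in (0 : ℝ)..W, w ^ 1 * (w / (1 - w / 2)) *
        Real.exp (D * w - R * logPotential w) := by
    refine intervalIntegral.integral_nonneg hW0 fun w hw => ?_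
    have := hw.1
    have : 0 < 1 - w / 2 := by linarith [hw.2]
    positivity
  have h5 := mul_nonneg hR.le h4
  norm_num at h h1 h2 h3 h5
  linarith

/-- The factor `R + D/2` on the right is the numerator in the mean of the state dependent diffusion;
the identity reduces the difference of means to a difference of integrals. -/
theorem mul_integral_exp_avg (hR : 0 < R) (D : ℝ) :
    R * ∫ w in Set.Ioi (0 : ℝ), (1 + Real.exp w) / 2 * Real.exp (D * w - R * expPotential w) =
      (R + D / 2) * tiltedMoment D R expPotential 0 + 1 / 2 := by
  have i0 := isPotential_expPotential.integrableOn_pow_mul_exp hR D 0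
  have i1 := isPotential_expPotential.integrableOn_pow_mul_deriv_mul_exp hR D 0
  have h := isPotential_expPotential.integral_deriv_mul_exp hR D
  simp only [pow_zero, one_mul] at i0 i1
  have e : ∀ w : ℝ, (1 + Real.exp w) / 2 * Real.exp (D * w - R * expPotential w) =
      Real.exp (D * w - R * expPotential w) +
        1 / 2 * ((Real.exp w - 1) * Real.exp (D * w - R * expPotential w)) := by
    intro w; ring
  simp only [e]
  rw [integral_add i0 (i1.const_mul _), integral_const_mul]
  simp only [tiltedMoment, pow_zero, one_mul] at h ⊢
  linarith

/-- The main comparison of the Laplace-type integrals of the queue and of the diffusion. -/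
theorem abs_integral_sub_integral_le (hD : 0 ≤ D) (hR : 1 ≤ R) (hW : 1 ≤ W) (hW2 : W < 2) :
    R * |(∫ w in (0 : ℝ)..W, 1 / (1 - w / 2) * Real.exp (D * w - R * logPotential w)) -
      ∫ w in Set.Ioi (0 : ℝ), (1 + Real.exp w) / 2 * Real.exp (D * w - R * expPotential w)| ≤
      2 * R ^ 2 * tiltedMoment D R expPotential 4 +
        2 * (D * tiltedMoment D R expPotential 2 + 2 * tiltedMoment D R expPotential 1) := by
  have hR0 : 0 < R := by linarith
  have hW0 : 0 ≤ W := by linarith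
  have P := isPotential_expPotential
  have j0 := P.integrableOn_pow_mul_exp hR0 D 0
  have j1 := P.integrableOn_pow_mul_exp hR0 D 1
  have j2 := P.integrableOn_pow_mul_exp hR0 D 2
  have j4 := P.integrableOn_pow_mul_exp hR0 D 4
  have d0 := P.integrableOn_pow_mul_deriv_mul_exp hR0 D 0
  have d2 := P.integrableOn_pow_mul_deriv_mul_exp hR0 D 2
  -- `1 + w/2 + w²/4` is the common second order Taylor polynomial of `(1 + e^w)/2` and `1 / (1 -
  -- w/2)`. `A` and `B` carry it with the two potentials; the Taylor remainders are treated
  -- separately.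
  set A : ℝ → ℝ := fun w => (1 + w / 2 + w ^ 2 / 4) * Real.exp (D * w - R * expPotential w) with hA
  set r : ℝ → ℝ := fun w => (Real.exp w - 1 - w - w ^ 2 / 2) / 2 *
    Real.exp (D * w - R * expPotential w) with hr
  set B : ℝ → ℝ := fun w => (1 + w / 2 + w ^ 2 / 4) * Real.exp (D * w - R * logPotential w) with hB
  have iA : IntegrableOn A (Set.Ioi 0) := by
    refine ((j0.add (j1.const_mul (1 / 2))).add (j2.const_mul (1 / 4))).congr_fun ?_
      measurableSet_Ioi
    intro w _
    simp only [hA, Pi.add_apply]; ring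
  have ir : IntegrableOn r (Set.Ioi 0) := by
    refine IntegrableOn.congr_fun (((d0.const_mul (1 / 2)).sub (j1.const_mul (1 / 2))).sub
      (j2.const_mul (1 / 4))) ?_ measurableSet_Ioi
    intro w _
    simp only [hr, Pi.sub_apply]; ring
  have iB : IntervalIntegrable B volume 0 W :=
    intervalIntegrable_mul_exp_logPotential hW0 hW2 (by fun_prop) D R
  have iq : IntervalIntegrable (fun w => w ^ 2 * (w / (1 - w / 2)) *
      Real.exp (D * w - R * logPotential w)) volume 0 W :=
    intervalIntegrable_mul_exp_logPotential hW0 hW2 ((continuous_pow 2).continuousOn.mul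
      (continuousOn_div_one_sub hW2 continuous_id)) D R
  -- The exact remainder of the weight is `1 / (1 - w/2) - (1 + w/2 + w²/4) = w³ / (8 (1 - w/2))`.
  have eB : ∫ w in (0 : ℝ)..W, 1 / (1 - w / 2) * Real.exp (D * w - R * logPotential w) =
      (∫ w in Set.Ioi (0 : ℝ), (Set.Ioc 0 W).indicator B w) + 1 / 8 * ∫ w in (0 : ℝ)..W,
        w ^ 2 * (w / (1 - w / 2)) * Real.exp (D * w - R * logPotential w) := by
    rw [setIntegral_indicator measurableSet_Ioc, Set.inter_eq_right.2 Set.Ioc_subset_Ioi_self,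
      ← intervalIntegral.integral_of_le hW0, ← intervalIntegral.integral_const_mul,
      ← intervalIntegral.integral_add iB (iq.const_mul _)]
    refine intervalIntegral.integral_congr fun w hw => ?_
    rw [Set.uIcc_of_le hW0] at hw
    have h1 : 1 - w / 2 ≠ 0 := by linarith [hw.2]
    have h2 : 2 - w ≠ 0 := by linarith [hw.2]
    simp only [hB]
    field_simp
    ring
  have eA : ∫ w in Set.Ioi (0 : ℝ), (1 + Real.exp w) / 2 *
      Real.exp (D * w - R * expPotential w) =
      (∫ w in Set.Ioi (0 : ℝ), A w) + ∫ w in Set.Ioi (0 : ℝ), r w := by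
    rw [← integral_add iA ir]
    refine setIntegral_congr_fun measurableSet_Ioi fun w _ => ?_
    simp only [hA, hr]; ring
  have iBi : IntegrableOn ((Set.Ioc 0 W).indicator B) (Set.Ioi 0) := by
    refine ((integrable_indicator_iff measurableSet_Ioc).2 ?_).integrableOn
    rwa [intervalIntegrable_iff_integrableOn_Ioc_of_le hW0] at iB
  have bound : ∀ w ∈ Set.Ioi (0 : ℝ), 0 ≤ A w - (Set.Ioc 0 W).indicator B w ∧
      A w - (Set.Ioc 0 W).indicator B w ≤
        2 * R * (w ^ 4 * Real.exp (D * w - R * expPotential w)) := by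
    intro w hw
    have hw0 : 0 < w := hw
    have hp := Real.exp_pos (D * w - R * expPotential w)
    have hpoly : 0 ≤ 1 + w / 2 + w ^ 2 / 4 := by positivity
    -- Beyond `1` no cancellation is needed, since `w^4` dominates the polynomial. This also covers
    -- the part past the cutoff `W ≥ 1`.
    have large : 1 ≤ w → A w ≤ 2 * R * (w ^ 4 * Real.exp (D * w - R * expPotential w)) := by
      intro h1
      have h2 : w ≤ w ^ 4 := le_self_pow₀ h1 (by norm_num)
      have h3 : w ^ 2 ≤ w ^ 4 := pow_le_pow_right₀ h1 (by norm_num)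
      have h4 : 1 ≤ w ^ 4 := one_le_pow₀ h1
      have h5 : 1 + w / 2 + w ^ 2 / 4 ≤ 2 * R * w ^ 4 := by nlinarith
      have := mul_le_mul_of_nonneg_right h5 hp.le
      simp only [hA]
      linarith
    have hBpos : 0 ≤ B w := by positivity
    by_cases hwW : w ≤ W
    · rw [Set.indicator_of_mem (show w ∈ Set.Ioc 0 W from ⟨hw0, hwW⟩)]
      have h1 := expPotential_le_logPotential hw0.le (hwW.trans_lt hW2)
      have h2 : Real.exp (D * w - R * logPotential w) ≤ Real.exp (D * w - R * expPotential w) := by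
        gcongr
      refine ⟨?_, ?_⟩
      · simp only [hA, hB]
        have := mul_le_mul_of_nonneg_left h2 hpoly
        linarith
      · rcases le_total 1 w with h3 | h3
        · linarith [large h3]
        · have h4 := logPotential_sub_expPotential_le hw0.le h3
          have h5 : Real.exp (D * w - R * logPotential w) =
              Real.exp (D * w - R * expPotential w) *
                Real.exp (-(R * (logPotential w - expPotential w))) := by
            rw [← Real.exp_add]; congr 1; ring
          have h6 := Real.one_sub_le_exp_neg (R * (logPotential w - expPotential w))
          have h7 := mul_le_mul_of_nonneg_left h4 hR0.le
          have h8 : (1 + w / 2 + w ^ 2 / 4) ≤ 2 := by nlinarith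
          have h9 : 1 - Real.exp (-(R * (logPotential w - expPotential w))) ≤ R * (w ^ 4 / 8) := by
            linarith
          have h10 : (1 + w / 2 + w ^ 2 / 4) *
              (1 - Real.exp (-(R * (logPotential w - expPotential w)))) ≤ 2 * R * w ^ 4 := by
            have h11 : 0 ≤ R * (w ^ 4 / 8) := by positivity
            calc _ ≤ (1 + w / 2 + w ^ 2 / 4) * (R * (w ^ 4 / 8)) :=
                  mul_le_mul_of_nonneg_left h9 hpoly
              _ ≤ 2 * (R * (w ^ 4 / 8)) := mul_le_mul_of_nonneg_right h8 h11
              _ ≤ 2 * R * w ^ 4 := by nlinarith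
          have := mul_le_mul_of_nonneg_right h10 hp.le
          simp only [hA, hB, h5]
          linarith
    · rw [Set.indicator_of_notMem (fun hm => hwW hm.2)]
      have hAp : 0 ≤ A w := by positivity
      push Not at hwW
      exact ⟨by linarith, by linarith [large (by linarith)]⟩
  have k1 : 0 ≤ (∫ w in Set.Ioi (0 : ℝ), A w) -
      ∫ w in Set.Ioi (0 : ℝ), (Set.Ioc 0 W).indicator B w := by
    rw [← integral_sub iA iBi]
    exact setIntegral_nonneg measurableSet_Ioi fun w hw => (bound w hw).1
  have k2 : (∫ w in Set.Ioi (0 : ℝ), A w) - (∫ w in Set.Ioi (0 : ℝ), (Set.Ioc 0 W).indicator B w) ≤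
      2 * R * tiltedMoment D R expPotential 4 := by
    rw [← integral_sub iA iBi, tiltedMoment, ← integral_const_mul]
    exact setIntegral_mono_on (iA.sub iBi) (j4.const_mul _) measurableSet_Ioi
      fun w hw => (bound w hw).2
  have k3 : 0 ≤ ∫ w in Set.Ioi (0 : ℝ), r w := by
    refine setIntegral_nonneg measurableSet_Ioi fun w hw => ?_
    have := Real.quadratic_le_exp_of_nonneg (le_of_lt hw : (0 : ℝ) ≤ w)
    refine mul_nonneg ?_ (Real.exp_pos _).le
    linarith
  have k4 : R * ∫ w in Set.Ioi (0 : ℝ), r w ≤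
      D * tiltedMoment D R expPotential 2 + 2 * tiltedMoment D R expPotential 1 := by
    have h := P.integral_pow_mul_deriv_mul_exp hR0 D 1
    norm_num at h
    rw [← h]
    refine mul_le_mul_of_nonneg_left ?_ hR0.le
    refine setIntegral_mono_on ir d2 measurableSet_Ioi fun w hw => ?_
    have hw0 : 0 < w := hw
    have h1 := exp_remainder_le hw0.le
    have h2 : 0 ≤ w ^ 2 * (Real.exp w - 1) :=
      mul_nonneg (by positivity) (by linarith [Real.add_one_le_exp w])
    have := mul_le_mul_of_nonneg_right (show (Real.exp w - 1 - w - w ^ 2 / 2) / 2 ≤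
      w ^ 2 * (Real.exp w - 1) by linarith) (Real.exp_pos (D * w - R * expPotential w)).le
    simp only [hr]
    linarith
  have k5 := mul_integral_sq_mul_deriv_le hD hR0 hW0 hW2
  have k6 : 0 ≤ ∫ w in (0 : ℝ)..W, w ^ 2 * (w / (1 - w / 2)) *
        Real.exp (D * w - R * logPotential w) := by
    refine intervalIntegral.integral_nonneg hW0 fun w hw => ?_
    have := hw.1
    have : 0 < 1 - w / 2 := by linarith [hw.2]
    positivity
  rw [eA, eB]
  have k7 := mul_nonneg hR0.le k6
  have k8 := mul_le_mul_of_nonneg_left k2 hR0.le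
  have k9 := mul_nonneg hR0.le k1
  have k10 := mul_nonneg hR0.le k3
  rw [← abs_of_pos hR0, ← abs_mul, abs_of_pos hR0, abs_le]
  constructor <;> linarith

end Interval

/-! ### Error bounds for the two approximations in terms of the integrals -/

theorem one_add_pow_le_of_integral_le {r z I : ℝ} (hr : 1 ≤ r) (hz : 0 < z)
    (h : ∫ w in (0 : ℝ)..1, Real.exp (r * z * w - r ^ 2 * w ^ 2) ≤ I) :
    (1 + z) ^ 4 ≤ 100000 * (1 + r * z * I) := by
  have h1 := one_add_pow_le_integral_exp hr hz
  have h2 := mul_le_mul_of_nonneg_left h (by positivity : 0 ≤ r * z)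
  linarith

/-- On `[0, 1]` one has `expPotential ≤ logPotential ≤ w²`, so a single explicit integral bounds
both normalizers from below. -/
theorem integral_exp_sq_le_tiltedMoment {r z : ℝ} (hr : 1 ≤ r) :
    ∫ w in (0 : ℝ)..1, Real.exp (r * z * w - r ^ 2 * w ^ 2) ≤
      tiltedMoment (r * z) (r ^ 2) expPotential 0 := by
  have hR : 0 < r ^ 2 := by positivity
  refine le_trans ?_ (integral_pow_mul_exp_logPotential_le (W := 1) hR zero_le_one (by norm_num) 0)
  refine intervalIntegral.integral_mono_on zero_le_one
    (Continuous.intervalIntegrable (by fun_prop) _ _)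
    (intervalIntegrable_mul_exp_logPotential zero_le_one (by norm_num) (by fun_prop) _ _) ?_
  intro w hw
  have := logPotential_le_sq hw.1 hw.2
  rw [pow_zero, one_mul]
  gcongr

theorem integral_exp_sq_le_integral_div {r z W : ℝ} (hW : 1 ≤ W) (hW2 : W < 2) :
    ∫ w in (0 : ℝ)..1, Real.exp (r * z * w - r ^ 2 * w ^ 2) ≤
      ∫ w in (0 : ℝ)..W, 1 / (1 - w / 2) * Real.exp (r * z * w - r ^ 2 * logPotential w) := by
  have hi : ∀ b : ℝ, 0 ≤ b → b < 2 → IntervalIntegrable (fun w => 1 / (1 - w / 2) *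
      Real.exp (r * z * w - r ^ 2 * logPotential w)) volume 0 b := fun b h0 h2 =>
    intervalIntegrable_mul_exp_logPotential h0 h2 (continuousOn_div_one_sub h2 continuous_const) _ _
  have hW0 : 0 ≤ W := by linarith
  calc _ ≤ ∫ w in (0 : ℝ)..1, 1 / (1 - w / 2) *
          Real.exp (r * z * w - r ^ 2 * logPotential w) := by
        refine intervalIntegral.integral_mono_on zero_le_one
          (Continuous.intervalIntegrable (by fun_prop) _ _) (hi 1 zero_le_one (by norm_num)) ?_
        intro w hw
        have h1 := logPotential_le_sq hw.1 hw.2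
        have h2 : Real.exp (r * z * w - r ^ 2 * w ^ 2) ≤
          Real.exp (r * z * w - r ^ 2 * logPotential w) := by gcongr
        refine h2.trans (le_mul_of_one_le_left (Real.exp_pos _).le ?_)
        rw [le_div_iff₀ (by linarith [hw.2])]
        linarith [hw.1]
    _ ≤ _ := by
        rw [intervalIntegral.integral_of_le zero_le_one, intervalIntegral.integral_of_le hW0]
        refine setIntegral_mono_set ?_ ?_ (Set.Ioc_subset_Ioc_right hW).eventuallyLE
        · exact (intervalIntegrable_iff_integrableOn_Ioc_of_le hW0).1 (hi W hW0 hW2)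
        · refine (ae_restrict_mem measurableSet_Ioc).mono fun w hw => ?_
          have : 0 < 1 - w / 2 := by linarith [hw.2]
          simp only [Pi.zero_apply]
          positivity

/-- The error of the approximation with state dependent diffusion coefficient, in terms of
explicit integrals. -/
theorem abs_sub_le_div_of_tail {r z W τ : ℝ} (hr : 1 ≤ r) (hz : 0 < z) (hW : 1 ≤ W)
    (hW2 : W < 2) (hτ : 0 ≤ τ)
    (hτ' : r ^ 2 * τ ≤ Real.exp (r * z * W - r ^ 2 * logPotential W)) {a b : ℝ}
    (ha : a = tiltedMoment (r * z) (r ^ 2) expPotential 0)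
    (hb : b = (∫ w in (0 : ℝ)..W, 1 / (1 - w / 2) *
      Real.exp (r * z * w - r ^ 2 * logPotential w)) + τ) :
    |r ^ 2 / (r * z * (1 + r * z * a)) - (r ^ 2 + r * z / 2) / (r * z * (1 + r * z * b))| ≤
      10000000 / r := by
  have hr0 : 0 < r := by linarith
  have hR : 0 < r ^ 2 := by positivity
  have hR1 : 1 ≤ r ^ 2 := one_le_pow₀ hr
  have hD : 0 < r * z := by positivity
  have hcmp := abs_integral_sub_integral_le hD.le hR1 hW hW2
  have hA := mul_integral_exp_avg hR (r * z)
  have hE := exp_logPotential_le hD.le hR hW hW2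
  obtain ⟨b0, b1, b2, -, b4⟩ := isPotential_expPotential.tiltedMoment_bounds hr0 hz rfl
  have low := one_add_pow_le_of_integral_le hr hz
    ((integral_exp_sq_le_integral_div (r := r) (z := z) hW hW2).trans (le_add_of_nonneg_right hτ))
  rw [← hb] at low
  have n1 := IsPotential.tiltedMoment_nonneg (r * z) (r ^ 2) expPotential 1
  have n2 := IsPotential.tiltedMoment_nonneg (r * z) (r ^ 2) expPotential 2
  rw [← ha] at b0 b1 b2 b4 hE hA
  have ha0 : 0 ≤ a := ha ▸ IsPotential.tiltedMoment_nonneg _ _ _ _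
  generalize tiltedMoment (r * z) (r ^ 2) expPotential 1 = J1 at *
  generalize tiltedMoment (r * z) (r ^ 2) expPotential 2 = J2 at *
  generalize tiltedMoment (r * z) (r ^ 2) expPotential 4 = J4 at *
  set KB := ∫ w in (0 : ℝ)..W, 1 / (1 - w / 2) *
      Real.exp (r * z * w - r ^ 2 * logPotential w)
  set KA := ∫ w in Set.Ioi (0 : ℝ), (1 + Real.exp w) / 2 *
      Real.exp (r * z * w - r ^ 2 * expPotential w)
  set F := 1 + r * z * a with hF
  set G := 1 + r * z * b with hG
  have hF0 : 0 < F := by positivity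
  have hG0 : 0 < G := by
    have : 0 < (1 + z) ^ 4 := by positivity
    linarith
  -- After scaling, the fourth moment, the Taylor remainders and `τ` each cost at most a multiple of
  -- `(1 + z)^3 F`.
  have step1 : r * (r ^ 2 * |b - KA|) ≤ 100 * (1 + z) ^ 3 * F := by
    have h1 : |b - KA| ≤ |KB - KA| + τ := by
      have : b - KA = (KB - KA) + τ := by rw [hb]; ring
      rw [this]
      exact (abs_add_le _ _).trans_eq (by rw [abs_of_nonneg hτ])
    have h2 := mul_le_mul_of_nonneg_left h1 hR.le
    have h3 : r ^ 2 * |b - KA| ≤ 2 * (r ^ 2) ^ 2 * J4 + 2 * (r * z * J2 + 2 * J1) +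
      (r * z * J1 + a) := by linarith
    have h4 := mul_le_mul_of_nonneg_left h3 hr0.le
    have e2 : r ^ 2 * J2 ≤ r ^ 3 * J2 :=
      mul_le_mul_of_nonneg_right (pow_le_pow_right₀ hr (by norm_num)) n2
    have e1 : r * J1 ≤ r ^ 2 * J1 :=
      mul_le_mul_of_nonneg_right (le_self_pow₀ hr (by norm_num)) n1
    have e3 := mul_le_mul_of_nonneg_left (e2.trans b2) hz.le
    have e4 := mul_le_mul_of_nonneg_left b1 hz.le
    have e5 := e1.trans b1
    have p1 : 0 ≤ z * F := by positivity
    have p2 : 0 ≤ z ^ 2 * F := by positivity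
    have p3 : 0 ≤ z ^ 3 * F := by positivity
    linarith
  have step2 : (1 + z) ^ 3 ≤ 100000 * G :=
    (pow_le_pow_right₀ (by linarith) (by norm_num)).trans low
  -- By `mul_integral_exp_avg` the cross-multiplied numerator is `r z · r² (b - KA)`, so the factor
  -- `1/(r z)`, singular as `z → 0`, cancels.
  have step3 : r ^ 2 / (r * z * F) - (r ^ 2 + r * z / 2) / (r * z * G) =
      r ^ 2 * (b - KA) * (-1) * (-1) * (1 / (F * G)) := by
    have e : r ^ 2 * G - (r ^ 2 + r * z / 2) * F = r * z * (r ^ 2 * (b - KA)) := by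
      have : r ^ 2 * (b - KA) = r ^ 2 * b - r ^ 2 * KA := by ring
      rw [this, hA, hF, hG]; ring
    have hr' := hr0.ne'
    have hz' := hz.ne'
    have hF' := hF0.ne'
    have hG' := hG0.ne'
    have e' : r ^ 2 / (r * z * F) - (r ^ 2 + r * z / 2) / (r * z * G) =
      (r ^ 2 * G - (r ^ 2 + r * z / 2) * F) / (r * z * (F * G)) := by
      field_simp
    rw [e', e]
    field_simp
  rw [step3, le_div_iff₀ hr0]
  have hFG : 0 < F * G := by positivity
  rw [abs_mul, abs_of_pos (by positivity : 0 < 1 / (F * G)), mul_one_div, div_mul_eq_mul_div,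
    div_le_iff₀ hFG]
  have : |r ^ 2 * (b - KA) * (-1) * (-1)| = r ^ 2 * |b - KA| := by
    rw [← abs_of_pos hR, ← abs_mul, abs_of_pos hR]; congr 1; ring
  rw [this]
  have := mul_le_mul_of_nonneg_right step2 hF0.le
  linarith

/-- The quadratic potential misses the cubic term of `expPotential`, hence a third moment and a
bounded rather than vanishing error. -/
theorem exp_gauss_sub_le {r z w : ℝ} (hr : 1 ≤ r) (hw : 0 < w) :
    Real.exp (r * z * w - r ^ 2 * (w ^ 2 / 2)) - Real.exp (r * z * w - r ^ 2 * expPotential w) ≤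
      r ^ 2 * (w ^ 3 * Real.exp (r * z * w - r ^ 2 * (w ^ 2 / 2))) := by
  have hR1 : 1 ≤ r ^ 2 := one_le_pow₀ hr
  have hp := Real.exp_pos (r * z * w - r ^ 2 * (w ^ 2 / 2))
  rcases le_total 1 w with h | h
  · have h1 : 1 ≤ w ^ 3 := one_le_pow₀ h
    have h2 : 1 ≤ r ^ 2 * w ^ 3 := one_le_mul_of_one_le_of_one_le hR1 h1
    have := mul_le_mul_of_nonneg_right h2 hp.le
    linarith [Real.exp_pos (r * z * w - r ^ 2 * expPotential w)]
  · have h1 := expPotential_le_logPotential hw.le (by linarith)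
    have h2 := logPotential_sub_sq_le hw.le h
    have h3 : Real.exp (r * z * w - r ^ 2 * expPotential w) =
        Real.exp (r * z * w - r ^ 2 * (w ^ 2 / 2)) *
          Real.exp (-(r ^ 2 * (expPotential w - w ^ 2 / 2))) := by
      rw [← Real.exp_add]; congr 1; ring
    have h4 := Real.one_sub_le_exp_neg (r ^ 2 * (expPotential w - w ^ 2 / 2))
    have h5 : 0 ≤ w ^ 3 := by positivity
    have h6 : r ^ 2 * (expPotential w - w ^ 2 / 2) ≤ r ^ 2 * w ^ 3 :=
      mul_le_mul_of_nonneg_left (by linarith) (by positivity)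
    have h7 := mul_le_mul_of_nonneg_right (show 1 - Real.exp (-(r ^ 2 *
      (expPotential w - w ^ 2 / 2))) ≤ r ^ 2 * w ^ 3 by linarith) hp.le
    rw [h3]
    linarith

/-- The error of the approximation with constant diffusion coefficient, in terms of explicit
integrals. -/
theorem abs_sub_le_of_gauss {r z : ℝ} (hr : 1 ≤ r) (hz : 0 < z) {a c : ℝ}
    (ha : a = tiltedMoment (r * z) (r ^ 2) expPotential 0)
    (hc : c = tiltedMoment (r * z) (r ^ 2) (fun w => w ^ 2 / 2) 0) :
    |r ^ 2 / (r * z * (1 + r * z * a)) - r ^ 2 / (r * z * (1 + r * z * c))| ≤ 10000000 := by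
  have hr0 : 0 < r := by linarith
  have hR : 0 < r ^ 2 := by positivity
  obtain ⟨-, -, -, b3, -⟩ := isPotential_sq.tiltedMoment_bounds hr0 hz rfl
  have low := one_add_pow_le_of_integral_le hr hz (integral_exp_sq_le_tiltedMoment (z := z) hr)
  have ia := isPotential_expPotential.integrableOn_pow_mul_exp hR (r * z) 0
  have ic := isPotential_sq.integrableOn_pow_mul_exp hR (r * z) 0
  have i3 := isPotential_sq.integrableOn_pow_mul_exp hR (r * z) 3
  have d0 : 0 ≤ c - a := by
    rw [ha, hc, tiltedMoment, tiltedMoment, ← integral_sub ic ia]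
    refine setIntegral_nonneg measurableSet_Ioi fun w hw => ?_
    have := isPotential_expPotential.sq_le w (le_of_lt hw)
    rw [pow_zero, one_mul, one_mul, sub_nonneg]
    gcongr
  have d1 : c - a ≤ r ^ 2 * tiltedMoment (r * z) (r ^ 2) (fun w => w ^ 2 / 2) 3 := by
    rw [ha, hc, tiltedMoment, tiltedMoment, ← integral_sub ic ia, tiltedMoment,
      ← integral_const_mul]
    refine setIntegral_mono_on (ic.sub ia) (i3.const_mul _) measurableSet_Ioi fun w hw => ?_
    rw [pow_zero, one_mul, one_mul]
    exact exp_gauss_sub_le hr hw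
  rw [← ha] at low
  rw [← hc] at b3
  have ha0 : 0 ≤ a := ha ▸ IsPotential.tiltedMoment_nonneg _ _ _ _
  have hc0 : 0 ≤ c := hc ▸ IsPotential.tiltedMoment_nonneg _ _ _ _
  generalize tiltedMoment (r * z) (r ^ 2) (fun w => w ^ 2 / 2) 3 = J3 at *
  set F := 1 + r * z * a with hF
  set G := 1 + r * z * c with hG
  have hF0 : 0 < F := by positivity
  have hG0 : 0 < G := by positivity
  have e : r ^ 2 / (r * z * F) - r ^ 2 / (r * z * G) = r ^ 2 * (c - a) / (F * G) := by
    have hr' := hr0.ne'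
    have hz' := hz.ne'
    have hF' := hF0.ne'
    have hG' := hG0.ne'
    have e' : G - F = r * z * (c - a) := by rw [hF, hG]; ring
    have e2 : r ^ 2 / (r * z * F) - r ^ 2 / (r * z * G) = r ^ 2 * (G - F) / (r * z * (F * G)) := by
      field_simp
    rw [e2, e']
    field_simp
  rw [e, abs_of_nonneg (by positivity), div_le_iff₀ (by positivity)]
  have h1 := mul_le_mul_of_nonneg_left d1 hR.le
  have h2 : (1 + z) ^ 2 ≤ 100000 * F :=
    (pow_le_pow_right₀ (by linarith) (by norm_num)).trans low
  have h3 := mul_le_mul_of_nonneg_right h2 hG0.le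
  have h4 : 0 ≤ F * G := by positivity
  linarith

/-! ### Laws given by a density and the mean of a diffusion with exponential tail -/

section LawOfDensity

variable {g : ℝ → ℝ}

theorem isProbabilityMeasure_lawOfDensity (hg : ∀ x, 0 ≤ g x) (hi : Integrable g)
    (hpos : 0 < ∫ x, g x) : IsProbabilityMeasure (lawOfDensity g) := by
  constructor
  have h0 : ∀ x, 0 ≤ (∫ y, g y)⁻¹ * g x := fun x => mul_nonneg (inv_nonneg.2 hpos.le) (hg x)
  rw [lawOfDensity, withDensity_apply _ MeasurableSet.univ, Measure.restrict_univ,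
    ← ofReal_integral_eq_lintegral_ofReal (hi.const_mul _) (Filter.Eventually.of_forall h0),
    integral_const_mul, inv_mul_cancel₀ hpos.ne', ENNReal.ofReal_one]

theorem integrable_id_lawOfDensity (hg : ∀ x, 0 ≤ g x) (hm : Measurable g)
    (hpos : 0 < ∫ x, g x) (hi : Integrable fun x => x * g x) :
    Integrable (fun y : ℝ => y) (lawOfDensity g) := by
  rw [lawOfDensity, integrable_withDensity_iff_integrable_smul' (by fun_prop)
    (Filter.Eventually.of_forall fun x => ENNReal.ofReal_lt_top)]
  refine (hi.const_mul (∫ y, g y)⁻¹).congr (Filter.Eventually.of_forall fun x => ?_)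
  simp only [smul_eq_mul]
  rw [ENNReal.toReal_ofReal (mul_nonneg (inv_nonneg.2 hpos.le) (hg x))]
  ring

theorem integral_id_lawOfDensity (hg : ∀ x, 0 ≤ g x) (hm : Measurable g)
    (hpos : 0 < ∫ x, g x) :
    ∫ y : ℝ, y ∂(lawOfDensity g) = (∫ x, x * g x) / ∫ x, g x := by
  rw [lawOfDensity, integral_withDensity_eq_integral_toReal_smul (by fun_prop)
    (Filter.Eventually.of_forall fun x => ENNReal.ofReal_lt_top), div_eq_inv_mul,
    ← integral_const_mul]
  refine integral_congr_ae (Filter.Eventually.of_forall fun x => ?_)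
  simp only [smul_eq_mul]
  rw [ENNReal.toReal_ofReal (mul_nonneg (inv_nonneg.2 hpos.le) (hg x))]
  ring

end LawOfDensity

section ExponentialTail

variable {θ : ℝ}

theorem tendsto_exp_tail (hθ : 0 < θ) (z : ℝ) :
    Filter.Tendsto (fun x => Real.exp (-(θ * (x - z)))) Filter.atTop (nhds 0) :=
  Real.tendsto_exp_neg_atTop_nhds_zero.comp
    ((Filter.tendsto_atTop_add_const_right _ (-z) Filter.tendsto_id).const_mul_atTop hθ)

theorem hasDerivAt_exp_tail (θ z x : ℝ) :
    HasDerivAt (fun x => Real.exp (-(θ * (x - z)))) (-θ * Real.exp (-(θ * (x - z)))) x :=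
  ((((hasDerivAt_id' x).sub_const z).const_mul θ).fun_neg.exp).congr_deriv (by ring)

theorem integrableOn_exp_tail (hθ : 0 < θ) (z : ℝ) :
    IntegrableOn (fun x => Real.exp (-(θ * (x - z)))) (Set.Ioi z) ∧
      ∫ x in Set.Ioi z, Real.exp (-(θ * (x - z))) = 1 / θ := by
  have hd : ∀ x ∈ Set.Ici z, HasDerivAt (fun x => -(1 / θ) * Real.exp (-(θ * (x - z))))
      (Real.exp (-(θ * (x - z)))) x := fun x _ =>
    ((hasDerivAt_exp_tail θ z x).const_mul _).congr_deriv (by field_simp)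
  have ht : Filter.Tendsto (fun x => -(1 / θ) * Real.exp (-(θ * (x - z)))) Filter.atTop
      (nhds 0) := by
    simpa using (tendsto_exp_tail hθ z).const_mul (-(1 / θ))
  refine ⟨integrableOn_Ioi_deriv_of_nonneg' hd (fun x _ => (Real.exp_pos _).le) ht, ?_⟩
  rw [integral_Ioi_of_hasDerivAt_of_nonneg' hd (fun x _ => (Real.exp_pos _).le) ht]
  simp

theorem integrableOn_mul_exp_tail (hθ : 0 < θ) (z : ℝ) :
    IntegrableOn (fun x => (x - z) * Real.exp (-(θ * (x - z)))) (Set.Ioi z) ∧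
      ∫ x in Set.Ioi z, (x - z) * Real.exp (-(θ * (x - z))) = 1 / θ ^ 2 := by
  have hd : ∀ x ∈ Set.Ici z,
      HasDerivAt (fun x => -(1 / θ) * ((x - z) + 1 / θ) * Real.exp (-(θ * (x - z))))
      ((x - z) * Real.exp (-(θ * (x - z)))) x := fun x _ =>
    ((((((hasDerivAt_id' x).sub_const z).add_const (1 / θ)).const_mul (-(1 / θ))).fun_mul
      (hasDerivAt_exp_tail θ z x))).congr_deriv (by field_simp; ring)
  have hn : ∀ x ∈ Set.Ioi z, 0 ≤ (x - z) * Real.exp (-(θ * (x - z))) := fun x hx =>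
    mul_nonneg (sub_nonneg.2 (le_of_lt hx)) (Real.exp_pos _).le
  have ht : Filter.Tendsto (fun x => -(1 / θ) * ((x - z) + 1 / θ) * Real.exp (-(θ * (x - z))))
      Filter.atTop (nhds 0) := by
    have h1 := (Real.tendsto_pow_mul_exp_neg_atTop_nhds_zero 1).comp
      ((Filter.tendsto_atTop_add_const_right _ (-z) Filter.tendsto_id).const_mul_atTop hθ)
    have h2 := (h1.const_mul (-(1 / θ ^ 2))).add ((tendsto_exp_tail hθ z).const_mul (-(1 / θ ^ 2)))
    rw [mul_zero, add_zero] at h2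
    refine h2.congr fun x => ?_
    simp only [Function.comp, id, pow_one, ← sub_eq_add_neg]
    field_simp
    ring
  refine ⟨integrableOn_Ioi_deriv_of_nonneg' hd hn ht, ?_⟩
  rw [integral_Ioi_of_hasDerivAt_of_nonneg' hd hn ht]
  simp
  field_simp

end ExponentialTail

/-- The law of a stationary diffusion with drift proportional to `-min x z`, with density `g` and
scale `S`, which is exponential with rate `θ` above `z`. -/
theorem lawOfDensity_facts {g S : ℝ → ℝ} {z κ θ A : ℝ} (hz : 0 < z) (hκ : 0 < κ) (hθ : 0 < θ)
    (hA : 0 ≤ A) (hgc : Continuous g) (hg : ∀ x, 0 < g x)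
    (hS : ∀ x, HasDerivAt S (-(κ * (min x z * g x))) x)
    (hbot : Filter.Tendsto S Filter.atBot (nhds 0))
    (hgz : ∀ x, z ≤ x → g x = g z * Real.exp (-(θ * (x - z))))
    (hSz : ∀ x, z ≤ x → S x = S z * Real.exp (-(θ * (x - z))))
    (hgA : ∫ x in Set.Iic z, g x = g z * A) :
    IsProbabilityMeasure (lawOfDensity g) ∧
      Integrable (fun y : ℝ => y) (lawOfDensity g) ∧
      ∫ y : ℝ, y ∂(lawOfDensity g) = 1 / (θ * (1 + θ * A)) := by
  obtain ⟨t0, t0'⟩ := integrableOn_exp_tail hθ z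
  obtain ⟨t1, t1'⟩ := integrableOn_mul_exp_tail hθ z
  have htop : Filter.Tendsto S Filter.atTop (nhds 0) := by
    have := (tendsto_exp_tail hθ z).const_mul (S z)
    rw [mul_zero] at this
    refine this.congr' ?_
    filter_upwards [Filter.eventually_ge_atTop z] with x hx
    exact (hSz x hx).symm
  have hminc : Continuous fun x => min x z * g x := by fun_prop
  have iloc : ∀ a b : ℝ, IntegrableOn (fun x => min x z * g x) (Set.Icc a b) := fun a b =>
    hminc.continuousOn.integrableOn_compact isCompact_Icc
  -- On the negative axis the integrand is, up to a constant, the derivative of `S` and has constant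
  -- sign. The limit of `S` at `-∞` thus gives integrability without any bound on `g`.
  have m0 : IntegrableOn (fun x => min x z * g x) (Set.Iic 0) := by
    have h1 : ∀ x ∈ Set.Ici (0 : ℝ), HasDerivAt (fun x => -S (-x))
        (-(κ * (min (-x) z * g (-x)))) x := by
      intro x _
      have := ((hS (-x)).scomp x (hasDerivAt_neg x)).fun_neg
      refine this.congr_deriv ?_
      simp
    have h2 := integrableOn_Ioi_deriv_of_nonneg' h1 (fun x hx => by
      have hx' : 0 < x := hx
      have h3 : min (-x) z ≤ 0 := (min_le_left _ _).trans (by linarith)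
      have := mul_nonneg hκ.le (mul_nonneg (neg_nonneg.2 h3) (hg (-x)).le)
      linarith) ((hbot.comp Filter.tendsto_neg_atTop_atBot).neg)
    have h3 : IntegrableOn (fun x => min (-x) z * g (-x)) (Set.Ioi 0) := by
      refine IntegrableOn.congr_fun (h2.const_mul (-(1 / κ))) (fun x _ => ?_) measurableSet_Ioi
      field_simp
    rw [integrableOn_Iic_iff_integrableOn_Iio]
    have h4 := h3.comp_neg
    simpa using h4
  have mz : IntegrableOn (fun x => min x z * g x) (Set.Iic z) := by
    rw [← Set.Iic_union_Icc_eq_Iic hz.le]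
    exact m0.union (iloc 0 z)
  have gz : IntegrableOn g (Set.Iic z) := by
    rw [← Set.Iic_union_Icc_eq_Iic (show -1 ≤ z by linarith)]
    refine IntegrableOn.union ?_ (hgc.continuousOn.integrableOn_compact isCompact_Icc)
    refine Integrable.mono' (m0.mono_set (Set.Iic_subset_Iic.2 (by norm_num : (-1 : ℝ) ≤ 0))).neg
      hgc.aestronglyMeasurable ?_
    refine (ae_restrict_mem measurableSet_Iic).mono fun x hx => ?_
    have hx' : x ≤ -1 := hx
    simp only [Pi.neg_apply]
    rw [Real.norm_of_nonneg (hg x).le, min_eq_left (by linarith)]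
    nlinarith [hg x]
  have gt : IntegrableOn g (Set.Ioi z) :=
    IntegrableOn.congr_fun (t0.const_mul (g z)) (fun x hx => (hgz x (le_of_lt hx)).symm)
      measurableSet_Ioi
  have mt : IntegrableOn (fun x => min x z * g x) (Set.Ioi z) := by
    refine IntegrableOn.congr_fun (gt.const_mul z) (fun x hx => ?_) measurableSet_Ioi
    rw [min_eq_right (le_of_lt hx)]
  have gi : Integrable g := by
    rw [← integrableOn_univ, ← Set.Iic_union_Ioi (a := z)]
    exact gz.union gt
  have mi : Integrable fun x => min x z * g x := by
    rw [← integrableOn_univ, ← Set.Iic_union_Ioi (a := z)]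
    exact mz.union mt
  have et : Set.EqOn (fun x => (x - z) * g x)
      (fun x => g z * ((x - z) * Real.exp (-(θ * (x - z))))) (Set.Ioi z) := by
    intro x hx
    simp only
    rw [hgz x (le_of_lt hx)]; ring
  have pt : IntegrableOn (fun x => (x - z) * g x) (Set.Ioi z) :=
    IntegrableOn.congr_fun (t1.const_mul (g z)) et.symm measurableSet_Ioi
  -- `x = min x z + (x - z)⁺`: the first part has mean zero by stationarity, the second only sees
  -- the exponential tail.
  have pind : ∀ x, x * g x = min x z * g x + (Set.Ioi z).indicator (fun x => (x - z) * g x) x := by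
    intro x
    by_cases hx : z < x
    · rw [Set.indicator_of_mem (show x ∈ Set.Ioi z from hx), min_eq_right hx.le]; ring
    · rw [Set.indicator_of_notMem (show x ∉ Set.Ioi z from hx), min_eq_left (not_lt.1 hx), add_zero]
  have pi' := (integrable_indicator_iff measurableSet_Ioi).2 pt
  have xi : Integrable fun x => x * g x := by
    simp only [pind]
    exact mi.add pi'
  have m_zero : ∫ x, min x z * g x = 0 := by
    have h1 := integral_of_hasDerivAt_of_tendsto hS (mi.const_mul κ).neg hbot htop
    rw [integral_neg, integral_const_mul, sub_zero, neg_eq_zero] at h1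
    exact (mul_eq_zero.1 h1).resolve_left hκ.ne'
  have x_int : ∫ x, x * g x = g z / θ ^ 2 := by
    simp only [pind]
    rw [integral_add mi pi', m_zero, integral_indicator measurableSet_Ioi,
      setIntegral_congr_fun measurableSet_Ioi et, integral_const_mul, t1']
    ring
  have g_int : ∫ x, g x = g z * A + g z / θ := by
    rw [← integral_add_compl measurableSet_Iic gi, Set.compl_Iic, hgA,
      setIntegral_congr_fun measurableSet_Ioi (fun x hx => hgz x (le_of_lt hx)),
      integral_const_mul, t0']
    ring
  have hgz0 := hg z
  have hpos : 0 < ∫ x, g x := by rw [g_int]; positivity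
  refine ⟨isProbabilityMeasure_lawOfDensity (fun x => (hg x).le) gi hpos,
    integrable_id_lawOfDensity (fun x => (hg x).le) hgc.measurable hpos xi, ?_⟩
  rw [integral_id_lawOfDensity (fun x => (hg x).le) hgc.measurable hpos, x_int, g_int]
  have : θ * A + 1 ≠ 0 := by positivity
  have : 1 + θ * A ≠ 0 := by positivity
  field_simp
  ring

/-! ### The two diffusion densities in the variable `w` -/

theorem eq_of_deriv_zero {f : ℝ → ℝ} {b : ℝ} (h0 : f 0 = 0)
    (hd : ∀ w ∈ Set.Icc 0 b, HasDerivAt f 0 w) (hb : 0 ≤ b) : f b = 0 := by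
  refine le_antisymm ?_ (nonneg_of_deriv_nonneg h0 hd (fun _ _ => le_rfl) hb)
  have := nonneg_of_deriv_nonneg (f := fun w => -f w) (f' := fun _ => 0) (b := b) (by simp [h0])
    (fun w hw => (hd w hw).fun_neg.congr_deriv (by simp)) (fun _ _ => le_rfl) hb
  linarith

theorem integral_Iic_eq_mul_integral_Ioi (f : ℝ → ℝ) (z : ℝ) {r : ℝ} (hr : 0 < r) :
    ∫ x in Set.Iic z, f x = r * ∫ w in Set.Ioi (0 : ℝ), f (z - r * w) := by
  have h1 := integral_comp_mul_left_Ioi (fun t => f (z - t)) 0 hr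
  rw [mul_zero, smul_eq_mul] at h1
  rw [h1, mul_inv_cancel_left₀ hr.ne', ← integral_indicator measurableSet_Iic,
    ← integral_Ici_eq_integral_Ioi, ← integral_indicator measurableSet_Ici,
    ← integral_sub_left_eq_self _ volume z]
  refine integral_congr_ae (Filter.Eventually.of_forall fun x => ?_)
  by_cases hx : 0 ≤ x
  · simp [Set.indicator_of_mem, hx]
  · simp [Set.indicator_of_notMem, hx]

theorem tendsto_exp_sub_sq (c : ℝ) {k : ℝ} (hk : 0 < k) :
    Filter.Tendsto (fun x : ℝ => Real.exp (c - k * (x * x))) Filter.atBot (nhds 0) := by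
  refine Real.tendsto_exp_atBot.comp ?_
  have h1 : Filter.Tendsto (fun x : ℝ => x * x) Filter.atBot Filter.atTop :=
    Filter.tendsto_id.atBot_mul_atBot₀ Filter.tendsto_id
  have h2 := Filter.tendsto_atBot_add_const_left _ c
    (Filter.tendsto_neg_atTop_atBot.comp (h1.const_mul_atTop hk))
  exact h2.congr fun x => by simp [sub_eq_add_neg]

theorem hasDerivAt_integral_zero {f : ℝ → ℝ} (hf : Continuous f) (x : ℝ) :
    HasDerivAt (fun x => ∫ y in (0 : ℝ)..x, f y) (f x) x :=
  (hf.integral_hasStrictDerivAt 0 x).hasDerivAt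

/-- Affine reparametrization of a primitive. -/
theorem hasDerivAt_comp_affine {L : ℝ → ℝ} {l z r w : ℝ} (hL : HasDerivAt L l (z - r * w)) :
    HasDerivAt (fun w => L (z - r * w)) (-(r * l)) w := by
  have h1 : HasDerivAt (fun w => z - r * w) (-r) w := by
    simpa using ((hasDerivAt_id' w).const_mul r).const_sub z
  refine (hL.comp w h1).congr_deriv (by ring)

theorem primitive_above {L ℓ : ℝ → ℝ} {z θ : ℝ} (hL : ∀ x, HasDerivAt L (ℓ x) x)
    (hℓ : ∀ x, z ≤ x → ℓ x = -θ) {x : ℝ} (hx : z ≤ x) : L x = L z + -(θ * (x - z)) := by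
  have h := eq_of_deriv_zero (f := fun t => L (z - (-1) * t) - L z + θ * t) (b := x - z) (by simp)
    (fun t ht => by
      refine (((hasDerivAt_comp_affine (hL (z - (-1) * t))).sub_const (L z)).fun_add
        ((hasDerivAt_id' t).const_mul θ)).congr_deriv ?_
      rw [hℓ _ (by linarith [ht.1])]
      ring) (sub_nonneg.2 hx)
  have e : z - (-1) * (x - z) = x := by ring
  simp only [e] at h
  linarith

/-- The stationary law of the diffusion with constant diffusion coefficient. -/
theorem lawOfDensity_gauss {r z : ℝ} (hr : 0 < r) (hz : 0 < z) {g : ℝ → ℝ}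
    (hgdef : g = fun x => Real.exp (∫ y in (0 : ℝ)..x, -(min y z))) :
    IsProbabilityMeasure (lawOfDensity g) ∧
      Integrable (fun y : ℝ => y) (lawOfDensity g) ∧
      ∫ y : ℝ, y ∂(lawOfDensity g) =
        1 / (z * (1 + r * z * tiltedMoment (r * z) (r ^ 2) (fun w => w ^ 2 / 2) 0)) := by
  set L : ℝ → ℝ := fun x => ∫ y in (0 : ℝ)..x, -(min y z) with hLdef
  have hL : ∀ x, HasDerivAt L (-(min x z)) x :=
    fun x => hasDerivAt_integral_zero (f := fun y => -(min y z)) (by fun_prop) x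
  have hg : ∀ x, g x = Real.exp (L x) := fun x => by rw [hgdef]
  have above : ∀ x, z ≤ x → g x = g z * Real.exp (-(z * (x - z))) := fun x hx => by
    rw [hg, hg, ← Real.exp_add, primitive_above hL (fun x hx => by rw [min_eq_right hx]) hx]
  -- The scale is quantified afresh: `1` is used for the limit at `-∞`, the given `r` for the
  -- integral.
  have below : ∀ r : ℝ, 0 < r → ∀ w, 0 ≤ w →
      g (z - r * w) = g z * Real.exp (r * z * w - r ^ 2 * (w ^ 2 / 2)) := by
    intro r hr w hw
    have h := eq_of_deriv_zero
      (f := fun w => L (z - r * w) - L z - (r * z * w - r ^ 2 * (w ^ 2 / 2))) (b := w) (by simp)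
      (fun t ht => by
        refine (((hasDerivAt_comp_affine (hL (z - r * t))).sub_const (L z)).fun_sub
          (((hasDerivAt_id' t).const_mul (r * z)).fun_sub
            (((hasDerivAt_pow 2 t).div_const 2).const_mul (r ^ 2)))).congr_deriv ?_
        rw [min_eq_left (by nlinarith [ht.1])]
        norm_num
        ring) hw
    rw [hg, hg, ← Real.exp_add]
    congr 1
    linarith
  have hbot : Filter.Tendsto g Filter.atBot (nhds 0) := by
    have h := (tendsto_exp_sub_sq (z ^ 2 / 2) (by norm_num : (0 : ℝ) < 1 / 2)).const_mul (g z)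
    rw [mul_zero] at h
    refine h.congr' ?_
    filter_upwards [Filter.eventually_le_atBot z] with x hx
    have := below 1 one_pos (z - x) (sub_nonneg.2 hx)
    rw [show z - 1 * (z - x) = x by ring] at this
    rw [this]
    congr 2
    ring
  have hgc : Continuous g := by
    have hLc : Continuous L := continuous_iff_continuousAt.2 fun x => (hL x).continuousAt
    rw [hgdef]
    exact hLc.rexp
  have := lawOfDensity_facts (g := g) (S := g) (z := z) (κ := 1) (θ := z)
    (A := r * tiltedMoment (r * z) (r ^ 2) (fun w => w ^ 2 / 2) 0) hz one_pos hz
    (mul_nonneg hr.le (IsPotential.tiltedMoment_nonneg _ _ _ _)) hgc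
    (fun x => by rw [hg]; exact Real.exp_pos _)
    (fun x => by
      rw [hg, one_mul, hgdef]
      exact (hL x).exp.congr_deriv (by ring))
    hbot above above
    (by
      have e : ∫ w in Set.Ioi (0 : ℝ), g (z - r * w) =
          ∫ w in Set.Ioi (0 : ℝ), g z * Real.exp (r * z * w - r ^ 2 * (w ^ 2 / 2)) :=
        setIntegral_congr_fun measurableSet_Ioi fun w hw => below r hr w (le_of_lt hw)
      rw [integral_Iic_eq_mul_integral_Ioi g z hr, e, integral_const_mul, tiltedMoment]
      simp only [pow_zero, one_mul]
      ring)
  convert this using 5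
  ring

/-- The stationary law of the diffusion with state dependent diffusion coefficient. -/
theorem lawOfDensity_stateDependent {mu r z : ℝ} (hmu : 0 < mu) (hr : 0 < r) (hz : 0 < z)
    {α g : ℝ → ℝ} (hα : α = fun x => mu * (1 + max 0 (1 + min x z / r)))
    (hgdef : g = fun x => 1 / α x *
      Real.exp (∫ y in (0 : ℝ)..x, 2 * (-(mu * min y z)) / α y)) :
    IsProbabilityMeasure (lawOfDensity g) ∧
      Integrable (fun y : ℝ => y) (lawOfDensity g) ∧
      ∃ W τ b : ℝ, 1 ≤ W ∧ W < 2 ∧ 0 ≤ τ ∧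
        r ^ 2 * τ ≤ Real.exp (r * z * W - r ^ 2 * logPotential W) ∧
        b = (∫ w in (0 : ℝ)..W, 1 / (1 - w / 2) *
          Real.exp (r * z * w - r ^ 2 * logPotential w)) + τ ∧
        ∫ y : ℝ, y ∂(lawOfDensity g) = (r ^ 2 + r * z / 2) / (r ^ 2 * z * (1 + r * z * b)) := by
  have hαpos : ∀ x, 0 < α x := fun x => by
    rw [hα]
    have : 0 ≤ max 0 (1 + min x z / r) := le_max_left _ _
    positivity
  have hαc : Continuous α := by rw [hα]; fun_prop
  set ℓ : ℝ → ℝ := fun y => 2 * (-(mu * min y z)) / α y with hℓ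
  have hℓc : Continuous ℓ :=
    Continuous.div (by fun_prop) hαc fun x => (hαpos x).ne'
  set L : ℝ → ℝ := fun x => ∫ y in (0 : ℝ)..x, ℓ y with hLdef
  have hL : ∀ x, HasDerivAt L (ℓ x) x := fun x => hasDerivAt_integral_zero hℓc x
  have hLc : Continuous L := continuous_iff_continuousAt.2 fun x => (hL x).continuousAt
  have hg : ∀ x, g x = 1 / α x * Real.exp (L x) := fun x => by rw [hgdef]
  have hgpos : ∀ x, 0 < g x := fun x => by
    rw [hg]; have := hαpos x; positivity
  have hgc : Continuous g := by
    rw [hgdef]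
    exact (Continuous.div continuous_const hαc fun x => (hαpos x).ne').mul hLc.rexp
  set m : ℝ := r ^ 2 + r * z / 2 with hm
  have hm0 : 0 < m := by positivity
  have hr' := hr.ne'
  have hmu' := hmu.ne'
  have hm' := hm0.ne'
  -- The substitution `x = z - (m/r) w` sends `[0, W]` onto `[-r, z]`, where the diffusion
  -- coefficient is affine and becomes `α z (1 - w/2)`.
  set W : ℝ := (z + r) * r / m with hW
  have hW1 : 1 ≤ W := by
    rw [hW, le_div_iff₀ hm0]
    nlinarith [mul_pos hr hz]
  have hW2 : W < 2 := by
    rw [hW, div_lt_iff₀ hm0]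
    nlinarith [mul_pos hr hr]
  have hW0 : 0 ≤ W := by linarith
  have hzW : z - m / r * W = -r := by
    rw [hW]; field_simp; ring
  have αz : α z = 2 * m * mu / r ^ 2 := by
    rw [hα]
    simp only [min_self]
    rw [max_eq_right (by positivity), hm]
    field_simp
    ring
  have αabove : ∀ x, z ≤ x → α x = α z := fun x hx => by
    rw [hα]; simp only [min_self, min_eq_right hx]
  have αmid : ∀ w ∈ Set.Icc 0 W, α (z - m / r * w) = α z * (1 - w / 2) := by
    intro w hw
    have h1 : m / r * w ≤ m / r * W := mul_le_mul_of_nonneg_left hw.2 (by positivity)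
    have h2 : 0 ≤ m / r * w := mul_nonneg (by positivity) hw.1
    have h3 : -r ≤ z - m / r * w := by linarith
    rw [αz, hα]
    simp only
    rw [min_eq_left (by linarith), max_eq_right]
    · have : 2 * m = 2 * r ^ 2 + r * z := by rw [hm]; ring
      field_simp
      linear_combination (-2) * this
    · have := div_le_div_of_nonneg_right h3 hr.le
      rw [neg_div, div_self hr'] at this
      linarith
  have αbelow : ∀ x, x ≤ -r → α x = mu := by
    intro x hx
    rw [hα]
    simp only
    rw [min_eq_left (by linarith), max_eq_left, add_zero, mul_one]
    have := div_le_div_of_nonneg_right hx hr.le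
    rw [neg_div, div_self hr'] at this
    linarith
  set θ : ℝ := r ^ 2 * z / m with hθ
  have hθ0 : 0 < θ := by positivity
  have Labove : ∀ x, z ≤ x → L x = L z + -(θ * (x - z)) := fun x hx =>
    primitive_above hL (fun x hx => by
      rw [hℓ, hθ]
      simp only
      rw [αabove x hx, αz, min_eq_right hx]
      field_simp) hx
  have Lmid : ∀ w ∈ Set.Icc 0 W,
      L (z - m / r * w) = L z + (r * z * w - r ^ 2 * logPotential w) := by
    intro w hw
    have h := eq_of_deriv_zero
      (f := fun w => L (z - m / r * w) - L z - (r * z * w - r ^ 2 * logPotential w)) (b := w)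
      (by simp [logPotential_zero])
      (fun t ht => by
        have htW : t ≤ W := ht.2.trans hw.2
        have h1 : 0 < 1 - t / 2 := by linarith
        have h2 : 0 < 2 - t := by linarith
        refine (((hasDerivAt_comp_affine (hL (z - m / r * t))).sub_const (L z)).fun_sub
          (((hasDerivAt_id' t).const_mul (r * z)).fun_sub
            ((hasDerivAt_logPotential (by linarith)).const_mul (r ^ 2)))).congr_deriv ?_
        have h3 : 0 ≤ m / r * t := mul_nonneg (by positivity) ht.1
        simp only [hℓ]
        rw [αmid t ⟨ht.1, htW⟩, αz, min_eq_left (by linarith)]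
        have h4 := h1.ne'
        have h5 := h2.ne'
        have : 2 * m = 2 * r ^ 2 + r * z := by rw [hm]; ring
        field_simp
        linear_combination (-t) * this) hw.1
    linarith
  have Lbelow : ∀ x, x ≤ -r → L x = L (-r) + (r ^ 2 - x * x) := by
    intro x hx
    have h := eq_of_deriv_zero
      (f := fun t => L (-r - 1 * t) - L (-r) - (-2 * r * t - t ^ 2)) (b := -r - x)
      (by simp)
      (fun t ht => by
        refine (((hasDerivAt_comp_affine (hL (-r - 1 * t))).sub_const (L (-r))).fun_sub
          (((hasDerivAt_id' t).const_mul (-2 * r)).fun_sub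
            (hasDerivAt_pow 2 t))).congr_deriv ?_
        simp only [hℓ]
        rw [αbelow _ (by linarith [ht.1]), min_eq_left (by linarith [ht.1])]
        field_simp
        norm_num
        ring) (by linarith)
    rw [show -r - 1 * (-r - x) = x by ring] at h
    linarith
  have hbot : Filter.Tendsto (fun x => Real.exp (L x)) Filter.atBot (nhds 0) := by
    refine (tendsto_exp_sub_sq (L (-r) + r ^ 2) one_pos).congr' ?_
    filter_upwards [Filter.eventually_le_atBot (-r)] with x hx
    rw [Lbelow x hx]
    congr 1
    ring
  have hS : ∀ x, HasDerivAt (fun x => Real.exp (L x)) (-(2 * mu * (min x z * g x))) x := by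
    intro x
    refine (hL x).exp.congr_deriv ?_
    have := (hαpos x).ne'
    rw [hg]
    simp only [hℓ]
    field_simp
  have gz : g z = r ^ 2 / (2 * m * mu) * Real.exp (L z) := by
    rw [hg, αz]; field_simp
  have tail_nonneg : 0 ≤ ∫ x in Set.Iic (-r), g x :=
    setIntegral_nonneg measurableSet_Iic fun x _ => (hgpos x).le
  have deriv_int : IntegrableOn (fun x => -(2 * mu * (min x z * g x))) (Set.Iic (-r)) := by
    have h1 : ∀ x ∈ Set.Ici r, HasDerivAt (fun x => -Real.exp (L (-x)))
        (-(2 * mu * (min (-x) z * g (-x)))) x := by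
      intro x _
      have := ((hS (-x)).scomp x (hasDerivAt_neg x)).fun_neg
      refine this.congr_deriv ?_
      simp
    have h2 := integrableOn_Ioi_deriv_of_nonneg' h1 (fun x hx => by
      have hx' : r < x := hx
      have h3 : min (-x) z ≤ 0 := (min_le_left _ _).trans (by linarith)
      have := mul_nonneg hmu.le (mul_nonneg (neg_nonneg.2 h3) (hgpos (-x)).le)
      linarith) ((hbot.comp Filter.tendsto_neg_atTop_atBot).neg)
    rw [integrableOn_Iic_iff_integrableOn_Iio]
    simpa using h2.comp_neg
  -- Below `-r` the drift is at least that at `-r`, so the mass there is bounded by the value of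
  -- `exp L` at `-r`.
  have min_r : ∀ x ∈ Set.Iic (-r), 2 * mu * r * g x ≤ -(2 * mu * (min x z * g x)) := by
    intro x hx
    have hx' : x ≤ -r := hx
    rw [min_eq_left (by linarith)]
    have := mul_nonneg (mul_nonneg hmu.le (hgpos x).le) (show 0 ≤ -r - x by linarith)
    linarith
  have tail_int : IntegrableOn g (Set.Iic (-r)) := by
    refine Integrable.mono' (deriv_int.const_mul (1 / (2 * mu * r))) hgc.aestronglyMeasurable ?_
    refine (ae_restrict_mem measurableSet_Iic).mono fun x hx => ?_
    rw [Real.norm_of_nonneg (hgpos x).le, one_div, ← div_eq_inv_mul, le_div_iff₀ (by positivity),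
      mul_comm]
    exact min_r x hx
  have tail_le : 2 * mu * r * ∫ x in Set.Iic (-r), g x ≤ Real.exp (L (-r)) := by
    have h1 := integral_Iic_of_hasDerivAt_of_tendsto' (fun x _ => hS x) deriv_int hbot
    rw [sub_zero] at h1
    rw [← h1, ← integral_const_mul]
    exact setIntegral_mono_on (tail_int.const_mul _) deriv_int measurableSet_Iic min_r
  have L_neg_r : L (-r) = L z + (r * z * W - r ^ 2 * logPotential W) := by
    rw [← hzW]; exact Lmid W ⟨hW0, le_rfl⟩
  -- The mass below `-r`, normalized so that the whole mass below `z` is `g z * (m / r) * b`.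
  set τ : ℝ := (∫ x in Set.Iic (-r), g x) * r / (m * g z) with hτ
  set b : ℝ := (∫ w in (0 : ℝ)..W, 1 / (1 - w / 2) *
          Real.exp (r * z * w - r ^ 2 * logPotential w)) + τ with hb
  have hgz := hgpos z
  have hgz' := hgz.ne'
  have hτ0 : 0 ≤ τ := by positivity
  have mid_int : ∫ x in (-r)..z, g x = g z * (m / r) * ∫ w in (0 : ℝ)..W, 1 / (1 - w / 2) *
          Real.exp (r * z * w - r ^ 2 * logPotential w) := by
    have h1 := intervalIntegral.integral_comp_sub_mul (a := 0) (b := W) g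
      (show m / r ≠ 0 by positivity) z
    rw [mul_zero, sub_zero, hzW, smul_eq_mul] at h1
    have h2 : ∫ x in (-r)..z, g x = m / r * ∫ w in (0 : ℝ)..W, g (z - m / r * w) := by
      rw [h1]; field_simp
    rw [h2, mul_comm (g z), mul_assoc, ← intervalIntegral.integral_const_mul (g z)]
    congr 1
    refine intervalIntegral.integral_congr fun w hw => ?_
    rw [Set.uIcc_of_le hW0] at hw
    rw [hg, hg, αmid w hw, Lmid w hw, Real.exp_add]
    have h3 := (hαpos z).ne'
    have h4 : 1 - w / 2 ≠ 0 := by linarith [hw.2]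
    have h5 : 2 - w ≠ 0 := by linarith [hw.2]
    field_simp
  have hgA : ∫ x in Set.Iic z, g x = g z * (m / r * b) := by
    have hle : -r ≤ z := by linarith
    have h1 : IntegrableOn g (Set.Ioc (-r) z) :=
      (hgc.integrableOn_Icc (a := -r) (b := z)).mono_set Set.Ioc_subset_Icc_self
    rw [← Set.Iic_union_Ioc_eq_Iic hle, setIntegral_union (Set.Iic_disjoint_Ioc le_rfl)
      measurableSet_Ioc tail_int h1, ← intervalIntegral.integral_of_le hle, mid_int, hb, hτ]
    generalize (∫ w in (0 : ℝ)..W, 1 / (1 - w / 2) *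
      Real.exp (r * z * w - r ^ 2 * logPotential w)) = K
    field_simp
    ring
  have hb0 : 0 ≤ b := by
    refine add_nonneg (intervalIntegral.integral_nonneg hW0 fun w hw => ?_) hτ0
    have : 0 < 1 - w / 2 := by linarith [hw.2]
    positivity
  obtain ⟨f1, f2, f3⟩ := lawOfDensity_facts (g := g) (S := fun x => Real.exp (L x)) (z := z)
    (κ := 2 * mu) (θ := θ) (A := m / r * b) hz (by positivity) hθ0 (by positivity) hgc hgpos hS hbot
    (fun x hx => by rw [hg, hg, αabove x hx, Labove x hx, Real.exp_add]; ring)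
    (fun x hx => by rw [Labove x hx, Real.exp_add]) hgA
  refine ⟨f1, f2, W, τ, b, hW1, hW2, hτ0, ?_, hb, ?_⟩
  · rw [L_neg_r, Real.exp_add] at tail_le
    have e : r ^ 2 * τ = 2 * mu * r * (∫ x in Set.Iic (-r), g x) / Real.exp (L z) := by
      have := (Real.exp_pos (L z)).ne'
      rw [hτ, gz]; field_simp
    rw [e, div_le_iff₀ (Real.exp_pos _)]
    linarith
  · rw [f3, hθ]
    have h1 : 1 + r ^ 2 * z / m * (m / r * b) = 1 + r * z * b := by field_simp
    rw [h1]
    have : 1 + r * z * b ≠ 0 := by positivity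
    field_simp

/-! ### Stationary weights of the queue -/

/-- The unnormalized stationary weights of the queue with offered load `R`. -/
def queueWeight (R : ℝ) (n : ℕ) : ℕ → ℝ
  | 0 => 1
  | k + 1 => queueWeight R n k * (R / (min (k + 1) n : ℕ))

section QueueWeight

variable {R : ℝ} {n : ℕ}

theorem queueWeight_pos (hR : 0 < R) (hn : 1 ≤ n) (k : ℕ) : 0 < queueWeight R n k := by
  induction k with
  | zero => exact one_pos
  | succ k ih =>
    have : 0 < min (k + 1) n := by omega
    have : (0 : ℝ) < (min (k + 1) n : ℕ) := by exact_mod_cast this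
    simp only [queueWeight]
    positivity

theorem min_mul_queueWeight_succ (hn : 1 ≤ n) (k : ℕ) :
    ((min (k + 1) n : ℕ) : ℝ) * queueWeight R n (k + 1) = R * queueWeight R n k := by
  have : min (k + 1) n ≠ 0 := by omega
  have : ((min (k + 1) n : ℕ) : ℝ) ≠ 0 := by exact_mod_cast this
  simp only [queueWeight]
  field_simp

theorem queueWeight_add (j : ℕ) : queueWeight R n (j + n) = queueWeight R n n * (R / n) ^ j := by
  induction j with
  | zero => simp
  | succ j ih =>
    rw [show j + 1 + n = (j + n) + 1 by ring, queueWeight, ih,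
      min_eq_right (by omega : n ≤ j + n + 1), pow_succ]
    ring

theorem queueWeight_of_le {k : ℕ} (hk : k ≤ n) : queueWeight R n k = R ^ k / k.factorial := by
  induction k with
  | zero => simp [queueWeight]
  | succ k ih =>
    rw [queueWeight, ih (by omega), min_eq_left hk, Nat.factorial_succ]
    push_cast
    have : (k.factorial : ℝ) ≠ 0 := by positivity
    have : (k : ℝ) + 1 ≠ 0 := by positivity
    field_simp
    ring

/-- With `u = R e^w` the integral is `e^R R^(-k) Γ(k, R)`, and this is the recursion of the
incomplete Gamma function. It holds because `V' = e^w - 1` shifts `k` by one. -/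
theorem mul_tiltedMoment_succ (hR : 0 < R) (k : ℕ) :
    R * tiltedMoment ((k + 1 : ℕ) - R) R expPotential 0 =
      1 + k * tiltedMoment (k - R) R expPotential 0 := by
  have h := isPotential_expPotential.integral_deriv_mul_exp hR (k - R)
  have i0 := isPotential_expPotential.integrableOn_pow_mul_exp hR (k - R) 0
  have i1 := isPotential_expPotential.integrableOn_pow_mul_exp hR ((k + 1 : ℕ) - R) 0
  have e : ∀ w : ℝ, (Real.exp w - 1) * Real.exp ((k - R) * w - R * expPotential w) =
      w ^ 0 * Real.exp (((k + 1 : ℕ) - R) * w - R * expPotential w) -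
        w ^ 0 * Real.exp ((k - R) * w - R * expPotential w) := by
    intro w
    rw [show ((k + 1 : ℕ) - R) * w - R * expPotential w =
      w + ((k - R) * w - R * expPotential w) by push_cast; ring, Real.exp_add]
    ring
  simp only [e] at h
  rw [integral_sub i1 i0] at h
  change R * (tiltedMoment ((k + 1 : ℕ) - R) R expPotential 0 -
    tiltedMoment (k - R) R expPotential 0) = _ at h
  linarith

/-- The partial exponential sum as an incomplete Gamma integral; this brings the queue into the same
Laplace form as the diffusions. -/
theorem sum_pow_div_factorial (hR : 0 < R) (k : ℕ) :
    ∑ i ∈ Finset.range k, R ^ i / i.factorial =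
      R ^ k / k.factorial * (k * tiltedMoment (k - R) R expPotential 0) := by
  induction k with
  | zero => simp
  | succ k ih =>
    rw [Finset.sum_range_succ, ih]
    have h := mul_tiltedMoment_succ hR k
    have h1 : R ^ k / k.factorial * (k * tiltedMoment (k - R) R expPotential 0) +
        R ^ k / k.factorial =
        R ^ k / k.factorial * (R * tiltedMoment ((k + 1 : ℕ) - R) R expPotential 0) := by
      rw [h]; ring
    rw [h1, Nat.factorial_succ]
    generalize tiltedMoment ((k + 1 : ℕ) - R) R expPotential 0 = t
    push_cast
    have : (k.factorial : ℝ) ≠ 0 := by positivity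
    have : (k : ℝ) + 1 ≠ 0 := by positivity
    field_simp
    ring

theorem norm_div_lt_one (hR : 0 < R) (hRn : R < n) : ‖R / n‖ < 1 := by
  have : (0 : ℝ) < n := by linarith
  rw [Real.norm_of_nonneg (by positivity), div_lt_one this]
  exact hRn

/-- The normalizing constant of the stationary weights. -/
def queueTotal (R : ℝ) (n : ℕ) : ℝ :=
  queueWeight R n n * (n / (n - R) * (1 + (n - R) * tiltedMoment (n - R) R expPotential 0))

theorem queueTotal_pos (hR : 0 < R) (hn : 1 ≤ n) (hRn : R < n) : 0 < queueTotal R n := by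
  have h1 : 0 < (n : ℝ) - R := by linarith
  have h2 := queueWeight_pos hR hn n
  have h3 := IsPotential.tiltedMoment_nonneg (n - R) R expPotential 0
  have h4 : (0 : ℝ) < n := by linarith
  rw [queueTotal]
  positivity

theorem hasSum_queueWeight (hR : 0 < R) (hRn : R < n) :
    HasSum (queueWeight R n) (queueTotal R n) := by
  have h1 : (n : ℝ) - R ≠ 0 := by linarith
  have h2 : (n : ℝ) ≠ 0 := by linarith
  have hg := (hasSum_geometric_of_norm_lt_one (norm_div_lt_one hR hRn)).mul_left (queueWeight R n n)
  simp only [← queueWeight_add] at hg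
  rw [hasSum_nat_add_iff] at hg
  suffices e : queueTotal R n = queueWeight R n n * (1 - R / n)⁻¹ +
      ∑ i ∈ Finset.range n, queueWeight R n i by rwa [e]
  rw [Finset.sum_congr rfl fun i hi => queueWeight_of_le (R := R) (Finset.mem_range.1 hi).le,
    sum_pow_div_factorial hR, ← queueWeight_of_le (R := R) le_rfl, queueTotal]
  have h3 : 1 - R / n = (n - R) / n := by field_simp
  rw [h3]
  field_simp

/-- Split `k = (k - min k n) + min k n`. The first part lives on the geometric tail; the second sums
to `R` times the total by detailed balance. -/
theorem hasSum_mul_queueWeight (hR : 0 < R) (hn : 1 ≤ n) (hRn : R < n) :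
    HasSum (fun k : ℕ => (k : ℝ) * queueWeight R n k)
      (queueWeight R n n * ((R / n) / (1 - R / n) ^ 2) + R * queueTotal R n) := by
  have hg := (hasSum_coe_mul_geometric_of_norm_lt_one (norm_div_lt_one hR hRn)).mul_left
    (queueWeight R n n)
  have e1 : ∀ j : ℕ, queueWeight R n n * (j * (R / n) ^ j) =
      (((j + n : ℕ) : ℝ) - (min (j + n) n : ℕ)) * queueWeight R n (j + n) := by
    intro j
    rw [queueWeight_add, min_eq_right (by omega)]
    push_cast
    ring
  simp only [e1] at hg
  rw [hasSum_nat_add_iff (f := fun k : ℕ => ((k : ℝ) - (min k n : ℕ)) * queueWeight R n k),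
    Finset.sum_eq_zero fun i hi => by
      rw [min_eq_left (Finset.mem_range.1 hi).le, sub_self, zero_mul], add_zero] at hg
  have hm := (hasSum_queueWeight hR hRn).mul_left R
  simp only [← min_mul_queueWeight_succ hn] at hm
  rw [hasSum_nat_add_iff (f := fun k : ℕ => ((min k n : ℕ) : ℝ) * queueWeight R n k)] at hm
  simp only [Finset.range_one, Finset.sum_singleton, Nat.zero_min, Nat.cast_zero, zero_mul,
    add_zero] at hm
  refine (hg.add hm).congr_fun ?_
  intro k
  ring

end QueueWeight

/-! ### Balance equations, uniqueness and the stationary mean -/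

section Stationary

variable {lam mu : ℝ} {n : ℕ}

theorem hasSum_rate_zero (x : ℕ → ℝ) :
    HasSum (fun j => x j * rate lam mu n j 0)
      (x 1 * (mu * (min 1 n : ℕ)) - x 0 * lam) := by
  have h := hasSum_sum_of_ne_finset_zero (L := SummationFilter.unconditional ℕ)
    (f := fun j => x j * rate lam mu n j 0)
    (s := Finset.range 2) (fun j hj => by
      rw [Finset.mem_range, not_lt] at hj
      simp only [rate]
      rw [if_neg (by omega), if_neg (by omega), if_neg (by omega), mul_zero])
  convert h using 1
  simp [Finset.sum_range_succ, rate]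
  ring

/-- Each balance equation is a difference of net flows across two neighbouring cuts; since the
equation at `0` makes the first flow vanish, all of them vanish. -/
theorem hasSum_rate_succ (x : ℕ → ℝ) (k : ℕ) :
    HasSum (fun j => x j * rate lam mu n j (k + 1))
      ((x (k + 2) * (mu * (min (k + 2) n : ℕ)) - x (k + 1) * lam) -
        (x (k + 1) * (mu * (min (k + 1) n : ℕ)) - x k * lam)) := by
  have h := hasSum_sum_of_ne_finset_zero (L := SummationFilter.unconditional ℕ)
    (f := fun j => x j * rate lam mu n j (k + 1))
    (s := {k, k + 1, k + 2}) (fun j hj => by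
      simp only [Finset.mem_insert, Finset.mem_singleton, not_or] at hj
      simp only [rate]
      rw [if_neg (by omega), if_neg (by omega), if_neg (by omega), mul_zero])
  convert h using 1
  rw [Finset.sum_insert (by simp), Finset.sum_insert (by simp), Finset.sum_singleton]
  have r0 : rate lam mu n k (k + 1) = lam := by simp [rate]
  have r1 : rate lam mu n (k + 1) (k + 1) = -(lam + mu * (min (k + 1) n : ℕ)) := by simp [rate]
  have r2 : rate lam mu n (k + 2) (k + 1) = mu * (min (k + 2) n : ℕ) := by
    rw [rate, if_neg (by omega), if_pos (by omega)]
  rw [r0, r1, r2]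
  ring

/-- The balance equations are equivalent to detailed balance. -/
theorem balance_iff (x : ℕ → ℝ) :
    (∀ k, HasSum (fun j => x j * rate lam mu n j k) 0) ↔
      ∀ k, x (k + 1) * (mu * (min (k + 1) n : ℕ)) - x k * lam = 0 := by
  constructor
  · intro h k
    induction k with
    | zero => exact (hasSum_rate_zero x).unique (h 0)
    | succ k ih =>
      have := (hasSum_rate_succ x k).unique (h (k + 1))
      rw [ih, sub_zero] at this
      exact this
  · intro h k
    cases k with
    | zero =>
      have := hasSum_rate_zero (lam := lam) (mu := mu) (n := n) x
      rwa [h 0] at this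
    | succ k =>
      have := hasSum_rate_succ (lam := lam) (mu := mu) (n := n) x k
      rwa [h k, h (k + 1), sub_zero] at this

theorem eq_mul_queueWeight (hmu : 0 < mu) (hn : 1 ≤ n) {x : ℕ → ℝ}
    (h : ∀ k, x (k + 1) * (mu * (min (k + 1) n : ℕ)) - x k * lam = 0) (k : ℕ) :
    x k = x 0 * queueWeight (load lam mu) n k := by
  induction k with
  | zero => simp [queueWeight]
  | succ k ih =>
    have h1 : min (k + 1) n ≠ 0 := by omega
    have h2 : ((min (k + 1) n : ℕ) : ℝ) ≠ 0 := by exact_mod_cast h1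
    have h3 := h k
    rw [ih] at h3
    have h4 := hmu.ne'
    rw [queueWeight, load]
    rw [load] at h3
    field_simp
    linarith

theorem IsStationary.real_singleton (hlam : 0 < lam) (hmu : 0 < mu) (hn : 1 ≤ n)
    (hRn : load lam mu < n) {π : Measure ℕ} (h : IsStationary lam mu n π) (k : ℕ) :
    π.real {k} = (queueTotal (load lam mu) n)⁻¹ * queueWeight (load lam mu) n k := by
  have hR : 0 < load lam mu := div_pos hlam hmu
  have hx := eq_mul_queueWeight (x := fun k => π.real {k}) hmu hn
    ((balance_iff (fun k => π.real {k})).1 h.balance)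
  have := h.isProbabilityMeasure
  have h1 := integral_countable (μ := π) (integrable_const (1 : ℝ))
  simp only [integral_const, probReal_univ, smul_eq_mul, mul_one] at h1
  have h2 := ((hasSum_queueWeight hR hRn).mul_left (π.real {0})).tsum_eq
  have h3 : 1 = π.real {0} * queueTotal (load lam mu) n := by
    rw [h1, ← h2]
    exact tsum_congr hx
  have h4 := queueTotal_pos hR hn hRn
  rw [hx k]
  congr 1
  exact eq_inv_of_mul_eq_one_left h3.symm

theorem existsUnique_isStationary (hlam : 0 < lam) (hmu : 0 < mu) (hn : 1 ≤ n)
    (hRn : load lam mu < n) : ∃! π : Measure ℕ, IsStationary lam mu n π := by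
  have hR : 0 < load lam mu := div_pos hlam hmu
  have hZ := queueTotal_pos hR hn hRn
  have hw := queueWeight_pos hR hn
  set x : ℕ → ℝ := fun k => (queueTotal (load lam mu) n)⁻¹ * queueWeight (load lam mu) n k with hx
  have hx0 : ∀ k, 0 ≤ x k := fun k => mul_nonneg (inv_nonneg.2 hZ.le) (hw k).le
  have hs : HasSum x 1 := by
    have := (hasSum_queueWeight hR hRn).mul_left (queueTotal (load lam mu) n)⁻¹
    rwa [inv_mul_cancel₀ hZ.ne'] at this
  set π₀ : Measure ℕ := Measure.sum fun k => ENNReal.ofReal (x k) • Measure.dirac k with hπ₀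
  have hsingle : ∀ k, π₀.real {k} = x k := fun k => by
    rw [measureReal_def, hπ₀, Measure.sum_smul_dirac_singleton, ENNReal.toReal_ofReal (hx0 k)]
  have hst : IsStationary lam mu n π₀ := by
    refine ⟨⟨?_⟩, ?_⟩
    · rw [hπ₀, Measure.sum_apply _ MeasurableSet.univ]
      simp only [Measure.smul_apply, measure_univ, smul_eq_mul, mul_one]
      rw [← ENNReal.ofReal_tsum_of_nonneg hx0 hs.summable, hs.tsum_eq, ENNReal.ofReal_one]
    · simp only [hsingle]
      refine (balance_iff x).2 fun k => ?_
      have h1 := min_mul_queueWeight_succ (R := load lam mu) hn k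
      have h2 : mu * load lam mu = lam := by
        rw [load]; field_simp
      have h3 : x (k + 1) * (mu * (min (k + 1) n : ℕ)) = (queueTotal (load lam mu) n)⁻¹ * mu *
          ((min (k + 1) n : ℕ) * queueWeight (load lam mu) n (k + 1)) := by
        simp only [hx]; ring
      rw [h3, h1, ← h2]
      simp only [hx]
      rw [h2]
      linear_combination ((queueTotal (load lam mu) n)⁻¹ * queueWeight (load lam mu) n k) * h2
  refine ⟨π₀, hst, fun π h => ?_⟩
  refine Measure.ext_of_singleton fun k => ?_
  have := h.isProbabilityMeasure
  have := hst.isProbabilityMeasure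
  rw [← measureReal_eq_measureReal_iff, h.real_singleton hlam hmu hn hRn, hsingle]

/-- The stationary mean of the queue. -/
theorem IsStationary.mean (hlam : 0 < lam) (hmu : 0 < mu) (hn : 1 ≤ n)
    (hRn : load lam mu < n) {π : Measure ℕ} (h : IsStationary lam mu n π) :
    Integrable (fun k : ℕ => (k : ℝ)) π ∧
      ∫ k : ℕ, (k : ℝ) ∂π = load lam mu + load lam mu / ((n - load lam mu) *
        (1 + (n - load lam mu) *
          tiltedMoment (n - load lam mu) (load lam mu) expPotential 0)) := by
  have hR : 0 < load lam mu := div_pos hlam hmu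
  have hZ := queueTotal_pos hR hn hRn
  have hprob := h.isProbabilityMeasure
  have hs := (hasSum_mul_queueWeight hR hn hRn).mul_left (queueTotal (load lam mu) n)⁻¹
  have e : ∀ k : ℕ, π.real {k} * (k : ℝ) =
      (queueTotal (load lam mu) n)⁻¹ * (k * queueWeight (load lam mu) n k) := fun k => by
    rw [h.real_singleton hlam hmu hn hRn]; ring
  simp only [← e] at hs
  have hi : Integrable (fun k : ℕ => (k : ℝ)) π := by
    rw [← Measure.sum_smul_dirac π, integrable_sum_dirac_iff (fun k => measure_ne_top π _)]
    simpa [measureReal_def] using hs.summable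
  refine ⟨hi, ?_⟩
  rw [integral_countable hi]
  simp only [smul_eq_mul]
  rw [hs.tsum_eq, queueTotal]
  have h1 : (0 : ℝ) < n - load lam mu := by linarith
  have h2 : (0 : ℝ) < n := by linarith
  have h3 := queueWeight_pos hR hn n
  have h4 := IsPotential.tiltedMoment_nonneg (n - load lam mu) (load lam mu) expPotential 0
  have h5 : 1 - load lam mu / n = (n - load lam mu) / n := by field_simp
  rw [h5]
  generalize tiltedMoment (n - load lam mu) (load lam mu) expPotential 0 = t at *
  have h6 : 0 < 1 + (n - load lam mu) * t := by positivity
  have h1' := h1.ne'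
  have h2' := h2.ne'
  have h3' := h3.ne'
  have h6' := h6.ne'
  field_simp
  ring

end Stationary

/-! ### Translation of the coefficients and assembly -/

variable {lam mu : ℝ} {n : ℕ}

theorem drift_eq (lam mu : ℝ) (n : ℕ) (x : ℝ) :
    drift lam mu n x = -(mu * min x (-zeta lam mu n)) := by
  rw [drift]
  rcases le_total x (-zeta lam mu n) with h | h
  · rw [max_eq_left (by linarith), min_eq_left h]; ring
  · rw [max_eq_right (by linarith), min_eq_right h]; ring

/-- The indicator switches exactly where `1 + min x z / √R` changes sign, so it is a positive part
and the coefficient is continuous. -/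
theorem diffusion_eq (hR : 0 < load lam mu) (hz : 0 < -zeta lam mu n) (x : ℝ) :
    diffusion lam mu n x =
      mu * (1 + max 0 (1 + min x (-zeta lam mu n) / √(load lam mu))) := by
  have hr := Real.sqrt_pos.2 hR
  have e : max (-(x + zeta lam mu n)) 0 + zeta lam mu n = -min x (-zeta lam mu n) := by
    rcases le_total x (-zeta lam mu n) with h | h
    · rw [max_eq_left (by linarith), min_eq_left h]; ring
    · rw [max_eq_right (by linarith), min_eq_right h]; ring
  rw [diffusion, e]
  congr 2
  split_ifs with h
  · have h1 : -√(load lam mu) ≤ min x (-zeta lam mu n) := le_min h.le (by linarith)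
    have h2 := div_le_div_of_nonneg_right h1 hr.le
    rw [neg_div, div_self hr.ne'] at h2
    rw [max_eq_right (by linarith)]
    ring
  · have h1 : min x (-zeta lam mu n) ≤ -√(load lam mu) := (min_le_left _ _).trans (not_lt.1 h)
    have h2 := div_le_div_of_nonneg_right h1 hr.le
    rw [neg_div, div_self hr.ne'] at h2
    rw [max_eq_left (by linarith)]

end ErlangC

end

theorem mainTheorem2 :
    ∃ C > (0 : ℝ), ∃ C₀ > (0 : ℝ), ∀ (n : ℕ) (lam mu : ℝ),
      1 ≤ n → 0 < lam → 0 < mu →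
      1 ≤ ErlangC.load lam mu → ErlangC.load lam mu < n →
      (∃! π : Measure ℕ, ErlangC.IsStationary lam mu n π) ∧
      IsProbabilityMeasure (ErlangC.lawY lam mu n) ∧
      Integrable (fun y : ℝ => y) (ErlangC.lawY lam mu n) ∧
      IsProbabilityMeasure (ErlangC.lawY₀ lam mu n) ∧
      Integrable (fun y : ℝ => y) (ErlangC.lawY₀ lam mu n) ∧
      ∀ π : Measure ℕ, ErlangC.IsStationary lam mu n π →
        Integrable (fun k : ℕ => (k : ℝ)) π ∧
        |(∫ k : ℕ, (k : ℝ) ∂π) - (ErlangC.load lam mu +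
            √(ErlangC.load lam mu) * ∫ y : ℝ, y ∂(ErlangC.lawY lam mu n))|
          ≤ C / √(ErlangC.load lam mu) ∧
        |(∫ k : ℕ, (k : ℝ) ∂π) - (ErlangC.load lam mu +
            √(ErlangC.load lam mu) * ∫ y : ℝ, y ∂(ErlangC.lawY₀ lam mu n))| ≤ C₀ := by
  -- `10000000 = 100 * 100000`: the moment constant times the constant of the normalizer bound. The
  -- second constant could be smaller.
  refine ⟨10000000, by norm_num, 10000000, by norm_num, ?_⟩
  intro n lam mu hn hlam hmu hR1 hRn
  have hR : 0 < ErlangC.load lam mu := by linarith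
  have hr1 : 1 ≤ √(ErlangC.load lam mu) := Real.one_le_sqrt.2 hR1
  have hsq : √(ErlangC.load lam mu) ^ 2 = ErlangC.load lam mu := Real.sq_sqrt hR.le
  have hr : 0 < √(ErlangC.load lam mu) := by linarith
  have hrz : √(ErlangC.load lam mu) * (-ErlangC.zeta lam mu n) = n - ErlangC.load lam mu := by
    have := hr.ne'
    rw [ErlangC.zeta]; field_simp; ring
  have hz : 0 < -ErlangC.zeta lam mu n := by
    refine pos_of_mul_pos_right (a := √(ErlangC.load lam mu)) ?_ hr.le
    rw [hrz]; linarith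
  obtain ⟨y1, y2, W, τ, b, hW, hW2, hτ, hτ', hb, y3⟩ :=
    ErlangC.lawOfDensity_stateDependent hmu hr hz (α := ErlangC.diffusion lam mu n)
      (funext (ErlangC.diffusion_eq hR hz)) rfl
  obtain ⟨g1, g2, g3⟩ := ErlangC.lawOfDensity_gauss hr hz rfl
  have eY : ErlangC.lawY lam mu n = ErlangC.lawOfDensity fun x =>
      1 / ErlangC.diffusion lam mu n x * Real.exp (∫ y in (0 : ℝ)..x,
        2 * (-(mu * min y (-ErlangC.zeta lam mu n))) / ErlangC.diffusion lam mu n y) := by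
    simp only [ErlangC.lawY, ErlangC.drift_eq]
  have eG : ErlangC.lawY₀ lam mu n = ErlangC.lawOfDensity fun x =>
      Real.exp (∫ y in (0 : ℝ)..x, -(min y (-ErlangC.zeta lam mu n))) := by
    have : ∀ y : ℝ, -(mu * min y (-ErlangC.zeta lam mu n)) / mu =
        -(min y (-ErlangC.zeta lam mu n)) := fun y => by
      have := hmu.ne'
      field_simp
    simp only [ErlangC.lawY₀, ErlangC.drift_eq, this]
  rw [← eY] at y1 y2 y3
  rw [← eG] at g1 g2 g3
  refine ⟨ErlangC.existsUnique_isStationary hlam hmu hn hRn, y1, y2, g1, g2, fun π hπ => ?_⟩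
  obtain ⟨x1, x2⟩ := hπ.mean hlam hmu hn hRn
  have errY := ErlangC.abs_sub_le_div_of_tail hr1 hz hW hW2 hτ hτ' rfl hb
  have errG := ErlangC.abs_sub_le_of_gauss hr1 hz rfl rfl
  refine ⟨x1, ?_, ?_⟩
  · refine le_of_eq_of_le (congrArg abs ?_) errY
    rw [x2, y3, hrz, hsq, add_sub_add_left_eq_sub]
    congr 1
    have h1 : ErlangC.load lam mu * -ErlangC.zeta lam mu n =
        √(ErlangC.load lam mu) * (n - ErlangC.load lam mu) := by
      rw [← hrz, ← mul_assoc, ← sq, hsq]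
    rw [h1, mul_assoc, ← mul_div_assoc, mul_div_mul_left _ _ hr.ne']
  · refine le_of_eq_of_le (congrArg abs ?_) errG
    rw [x2, g3, hrz, hsq, add_sub_add_left_eq_sub]
    congr 1
    have key : ∀ r z L G : ℝ, r ≠ 0 → r ^ 2 = L → r * (1 / (z * G)) = L / (r * z * G) := by
      rintro r z L G hr rfl
      rw [mul_one_div, mul_assoc, sq, mul_div_mul_left _ _ hr]
    rw [key _ _ _ _ hr.ne' hsq, hrz]
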